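/- Let $G$ be a finite-dimensional Lie group with Lie algebra $\mathfrak g$, let $\pi:P\to M$ be a smooth principal right $G$-bundle (action $\Phi_g(p)=p\cdot g$) over a compact manifold $M$ without boundary, let $g$ be a Riemannian metric on $M$ and let $\gamma$ be an $\mathrm{Ad}$-invariant inner product on $\mathfrak g$. For $\xi\in\mathfrak g$ let $\xi_P(p)=\frac{d}{dt}|_{t=0}\,p\cdot\exp(t\xi)$. **Spaces** (all objects smooth). - $\mathcal F(M)=C^\infty(M,\mathbb R)$. - $\mathcal Conn(P)$ is the space of principal connections, i.e. of forms $\mathcal A\in\Omega^1(P,\mathfrak g)$ with $\Phi_g^*\mathcal A=\mathrm{Ad}_{g^{-1}}\circ\mathcal A$ and $\mathcal A(\xi_P)=\xi$. Let $\overline{\Omega^1}(P,\mathfrak g)$ be the space of forms $\omega\in\Omega^1(P,\mathfrak g)$ with $\Phi_g^*\omega=\mathrm{Ad}_{g^{-1}}\circ\omega$ and $\omega(\xi_P)=0$. Put $T^*\mathcal Conn(P)=\mathcal Conn(P)\times\overline{\Omega^1}(P,\mathfrak g)$ (identification by the $L^2$ pairing). - $\mathcal F_G(P,\mathfrak g)$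 is the space of $f:P\to\mathfrak g$ with $f\circ\Phi_g=\mathrm{Ad}_{g^{-1}}\circ f$, and $\mathcal F_G(P,\mathfrak g^*)$ that of $\nu:P\to\mathfrak g^*$ with $\nu\circ\Phi_g=\mathrm{Ad}_g^*\circ\nu$, where $\mathrm{Ad}_g^*$ is the transpose of $\mathrm{Ad}_g$. - $\mathfrak{aut}(P)$ is the space of $G$-invariant vector fields on $P$, $\mathfrak{gau}(P)\subset\mathfrak{aut}(P)$ that of the vertical ones, and $\sigma(f)(p)=f(p)_P(p)$ for $f\in\mathcal F_G(P,\mathfrak g)$. - $\mathfrak s=\mathfrak{aut}(P)\,\circledS\,(\mathcal F(M)\times\mathcal F(M))$ and $\mathfrak k=\mathfrak X(M)\,\circledS\,(\mathcal F(M)\times\mathcal F(M))$, the latter being the Lie algebra of $K=\mathcal D(M)\,\circledS\,(\mathcal F(M)\times\mathcal F(M))$. Their (regular) duals are $\mathfrak s^*=\Omega^1_G(P)\times\mathcal F(M)\times\mathcal F(M)$, with $\Omega^1_G(P)$ the $G$-invariant one-forms on $P$, and $\mathfrak k^*=\Omega^1(M)\times\mathcal F(M)\times\mathcal F(M)$.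 These spaces carry their standard smooth structure as spaces of smooth functions and forms: a family depending on finitely many real parameters is smooth iff it is jointly smooth in the parameters and the point, a map is smooth iff it takes smooth families to smooth families, and subsets carry the induced structure. A diffeomorphism is a bijection that is smooth in both directions. **Maps.** $\mathrm{Hor}_{\mathcal A}(p):T_{\pi(p)}M\to T_pP$ is the horizontal lift for $\mathcal A$. The map $\mathbb J:T^*P\to\mathfrak g^*$ is $\mathbb J(\alpha_p)(\xi)=\alpha_p(\xi_P(p))$. The covariant codifferential $\delta^{\mathcal A}:\overline{\Omega^1}(P,\mathfrak g)\to\mathcal F_G(P,\mathfrak g)$ is given in local coordinates of $M$ by $\delta^{\mathcal A}\mathcal Y=-|g|^{-1/2}\,\nabla^{\mathcal A}_i\bigl(|g|^{1/2}g^{ij}\mathcal Y_j\bigr)$, where $\mathcal Y_j=\mathcal Y(\mathrm{Hor}_{\mathcal A}\partial_j)$ and $\nabla^{\mathcal A}_i$ is differentiation along $\mathrm{Hor}_{\mathcal A}\partial_i$. The gauge momentum map is $$\mathbf J_{\mathfrak s^*}(\mathbf M,\rho,s,\mathcal A,\mathcal Y)=\sigma\bigl(\delta^{\mathcal A}\mathcal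 Y-\mathcal A(V)\bigr)\in\mathfrak{gau}(P),$$ where $V\in\mathfrak{aut}(P)$ is the field with $\mathbf M(u)=g(T\pi V,T\pi u)+\gamma(\mathcal A(V),\mathcal A(u))$ for all $u$. The gauge group $\mathcal Gau(P)$ of $G$-equivariant diffeomorphisms $\eta$ of $P$ with $\pi\circ\eta=\pi$ acts on $\mathfrak s^*\times T^*\mathcal Conn(P)$ by $(\mathbf M,\rho,s,\mathcal A,\mathcal Y)\mapsto(\mathrm{Ad}^*_\eta\mathbf M,\rho,s,\eta^*\mathcal A,\eta^*\mathcal Y)$, where $\mathrm{Ad}^*_\eta\mathbf M=\eta^*\mathbf M$. **Proposition.** There is a diffeomorphism $$i:\mathfrak s^*\times T^*\mathcal Conn(P)\to\mathfrak k^*\times\mathcal F_G(P,\mathfrak g^*)\times T^*\mathcal Conn(P)$$ given by $$i(\mathbf M,\rho,s,\mathcal A,\mathcal Y)=\bigl((\mathrm{Hor}_{\mathcal A})^*\circ\mathbf M,\ \rho,\ s,\ \mathbb J\circ\mathbf M,\ \mathcal A,\ -\mathcal Y\bigr),$$ where $n=(\mathrm{Hor}_{\mathcal A})^*\circ\mathbf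 M\in\Omega^1(M)$ is determined by $n(\pi(p))(v)=\mathbf M(p)(\mathrm{Hor}_{\mathcal A}(p)v)$. It is gauge-equivariant for the above action and the action $(n,\rho,s,\nu,\mathcal A,\mathcal E)\mapsto(n,\rho,s,\nu\circ\eta,\eta^*\mathcal A,\eta^*\mathcal E)$ on the target. For $\mathbf N\in\mathfrak{gau}(P)$ and $f\in\mathcal F_G(P,\mathfrak g)$ with $\sigma(f)=\mathbf N$, $$i\bigl(\mathbf J_{\mathfrak s^*}^{-1}(\mathbf N)\bigr)=\{(n,\rho,s,\nu,\mathcal A,\mathcal E)\mid \nu+\gamma(\delta^{\mathcal A}\mathcal E+f,\cdot)=0\}.$$ Finally, for every $\mathbf N\in\mathfrak{gau}(P)$, the map $i$ followed by forgetting $\nu$ is a diffeomorphism from $\mathbf J_{\mathfrak s^*}^{-1}(\mathbf N)$ onto $\mathfrak k^*\times T^*\mathcal Conn(P)$. -/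

import Mathlib

open scoped Manifold ContDiff
open MulOpposite Diffeology

noncomputable section

namespace EYM

/-! ## Smooth structures on the infinite-dimensional spaces

All spaces of smooth functions, forms and connections carry their standard (functional) smooth
structure, expressed with Mathlib's diffeologies: a finite-dimensional family `p : ℝⁿ → X` of
functions (forms, connections) is smooth iff it is jointly smooth in the parameter and in the
argument.  By the exponential law these are exactly the smooth families for the Fréchet `C^∞`
topology, and a map between Fréchet manifolds of this kind is smooth iff it sends smooth families
to smooth families (convenient calculus).
-/

section Diffeologies

/-- The functional diffeology on a type `X` whose elements are, through `ev`, maps from a manifold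
`N` to a normed space `V`. -/
@[reducible]
def functionalDiffeology {E H N V X : Type*} [NormedAddCommGroup E] [NormedSpace ℝ E]
    [TopologicalSpace H] (J : ModelWithCorners ℝ E H) [TopologicalSpace N] [ChartedSpace H N]
    [NormedAddCommGroup V] [NormedSpace ℝ V] (ev : X → N → V)
    (hev : ∀ x, ContMDiff J 𝓘(ℝ, V) ∞ (ev x)) : DiffeologicalSpace X :=
  DiffeologicalSpace.ofCorePlotsOn
    { isPlotOn := fun {n u} _ p =>
        ContMDiffOn (𝓘(ℝ, EuclideanSpace ℝ (Fin n)).prod J) 𝓘(ℝ, V) ∞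
          (fun y : EuclideanSpace ℝ (Fin n) × N => ev (p y.1) y.2) (u ×ˢ Set.univ)
      isPlotOn_congr := fun {n u} hu p q h => by
        refine contMDiffOn_congr fun y hy => ?_
        rw [h hy.1]
      isPlot := fun {n} p =>
        ContMDiff (𝓘(ℝ, EuclideanSpace ℝ (Fin n)).prod J) 𝓘(ℝ, V) ∞
          (fun y : EuclideanSpace ℝ (Fin n) × N => ev (p y.1) y.2)
      isPlotOn_univ := by
        intro n p
        rw [Set.univ_prod_univ]
        exact contMDiffOn_univ
      isPlot_const := fun x => (hev x).comp contMDiff_snd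
      isPlotOn_reparam := fun {n m u v hu} hv {p f} h hp hf => by
        have h1 : ContMDiffOn (𝓘(ℝ, EuclideanSpace ℝ (Fin m)).prod J)
            (𝓘(ℝ, EuclideanSpace ℝ (Fin n)).prod J) ∞
            (fun y : EuclideanSpace ℝ (Fin m) × N => (f y.1, y.2)) (v ×ˢ Set.univ) :=
          (hf.contMDiffOn.comp contMDiffOn_fst (fun y hy => hy.1)).prodMk contMDiffOn_snd
        exact hp.comp h1 (fun y hy => ⟨h hy.1, trivial⟩)
      locality := fun {n u} hu {p} hp => by
        intro y hy
        obtain ⟨v, hv, hyv, h⟩ := hp y.1 hy.1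
        exact ((h y ⟨hyv, trivial⟩).contMDiffAt
          ((hv.prod isOpen_univ).mem_nhds ⟨hyv, trivial⟩)).contMDiffWithinAt }

/-- The diffeology induced on `X` by a map into a diffeological space. -/
@[reducible]
def inducedDiffeology {X Y : Type*} [DiffeologicalSpace Y] (f : X → Y) : DiffeologicalSpace X where
  plots _ := {p | IsPlot (f ∘ p)}
  constant_plots x := isPlot_const (x := f x)
  plot_reparam hp hf := isPlot_reparam (X := Y) hp hf
  locality h := DiffeologicalSpace.locality (X := Y) h

/-- The product diffeology. -/
instance prodDiffeology {X Y : Type*} [DiffeologicalSpace X] [DiffeologicalSpace Y] :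
    DiffeologicalSpace (X × Y) where
  plots _ := {p | IsPlot (fun t => (p t).1) ∧ IsPlot (fun t => (p t).2)}
  constant_plots x := ⟨isPlot_const (x := x.1), isPlot_const (x := x.2)⟩
  plot_reparam hp hf := ⟨isPlot_reparam hp.1 hf, isPlot_reparam hp.2 hf⟩
  locality h := by
    constructor
    · refine DiffeologicalSpace.locality (X := X) fun x => ?_
      obtain ⟨u, hu, hx, H⟩ := h x
      exact ⟨u, hu, hx, fun hf hc => (H hf hc).1⟩
    · refine DiffeologicalSpace.locality (X := Y) fun x => ?_
      obtain ⟨u, hu, hx, H⟩ := h x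
      exact ⟨u, hu, hx, fun hf hc => (H hf hc).2⟩

/-- The subset diffeology. -/
instance subsetDiffeology {X : Type*} [DiffeologicalSpace X] (S : Set X) :
    DiffeologicalSpace S :=
  inducedDiffeology (Subtype.val : S → X)

/-- A bijection that is smooth in both directions. -/
def IsDiffeo {X Y : Type*} [DiffeologicalSpace X] [DiffeologicalSpace Y] (e : X ≃ Y) : Prop :=
  DSmooth e ∧ DSmooth e.symm

end Diffeologies

/-! ## One-forms -/

section OneForms

variable (E N V : Type*) [NormedAddCommGroup E] [NormedSpace ℝ E] [TopologicalSpace N]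
  [ChartedSpace E N] [IsManifold 𝓘(ℝ, E) ∞ N] [NormedAddCommGroup V] [NormedSpace ℝ V]

/-- `Ω¹(N, V)`: smooth `V`-valued one-forms on `N`, i.e. fibrewise linear maps `TN → V` that are
smooth on the tangent bundle. -/
structure OneForm where
  toFun : ∀ x : N, TangentSpace 𝓘(ℝ, E) x →L[ℝ] V
  smooth : ContMDiff 𝓘(ℝ, E).tangent 𝓘(ℝ, V) ∞
    (fun v : TangentBundle 𝓘(ℝ, E) N => toFun v.1 v.2)

instance : CoeFun (OneForm E N V) (fun _ => ∀ x : N, TangentSpace 𝓘(ℝ, E) x →L[ℝ] V) :=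
  ⟨OneForm.toFun⟩

instance : DiffeologicalSpace (OneForm E N V) :=
  functionalDiffeology 𝓘(ℝ, E).tangent
    (fun (α : OneForm E N V) (v : TangentBundle 𝓘(ℝ, E) N) => α v.1 v.2) (fun α => α.smooth)

variable {E N V}

/-- The pull-back `φ^*α` of a one-form by a diffeomorphism. -/
def OneForm.pullback (φ : N ≃ₘ^∞⟮𝓘(ℝ, E), 𝓘(ℝ, E)⟯ N) (α : OneForm E N V) : OneForm E N V where
  toFun x := (α (φ x)).comp (mfderiv 𝓘(ℝ, E) 𝓘(ℝ, E) φ x)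
  smooth := α.smooth.comp
    (φ.contMDiff.contMDiff_tangentMap (m := ∞) (n := ∞) le_rfl)

theorem OneForm.congr_point (α : OneForm E N V) {x y : N} {v w : E} (h : x = y) (h' : v = w) :
    α.toFun x v = α.toFun y w := by
  subst h h'
  rfl

/-- The form `-α`. -/
def OneForm.neg (α : OneForm E N V) : OneForm E N V where
  toFun x := -α x
  smooth := α.smooth.neg

end OneForms

/-- `F(M) = C^∞(M, ℝ)`. -/
abbrev SmoothFun (E N : Type*) [NormedAddCommGroup E] [NormedSpace ℝ E] [TopologicalSpace N]
    [ChartedSpace E N] : Type _ :=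
  C^∞⟮𝓘(ℝ, E), N; 𝓘(ℝ, ℝ), ℝ⟯

instance (E N : Type*) [NormedAddCommGroup E] [NormedSpace ℝ E] [TopologicalSpace N]
    [ChartedSpace E N] : DiffeologicalSpace (SmoothFun E N) :=
  functionalDiffeology 𝓘(ℝ, E) (fun (f : SmoothFun E N) (x : N) => f x) (fun f => f.contMDiff)

/-! ## Principal bundles

The Lie group `G`, the total space `P` and the base `M` are modelled on the finite-dimensional
spaces `EG`, `EP`, `EM`.  The Lie algebra `𝔤 = T₁G` has underlying vector space `EG`.
The right action of `g : G` on `p : P` is written `op g • p`. -/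

section Bundle

/-- A smooth principal right `G`-bundle `proj : P → M`. -/
structure PrincipalBundle (EG EP EM G P M : Type*)
    [NormedAddCommGroup EG] [NormedSpace ℝ EG] [NormedAddCommGroup EP] [NormedSpace ℝ EP]
    [NormedAddCommGroup EM] [NormedSpace ℝ EM]
    [TopologicalSpace G] [ChartedSpace EG G] [Group G] [LieGroup 𝓘(ℝ, EG) ∞ G]
    [TopologicalSpace P] [ChartedSpace EP P] [IsManifold 𝓘(ℝ, EP) ∞ P]
    [TopologicalSpace M] [ChartedSpace EM M] [IsManifold 𝓘(ℝ, EM) ∞ M]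
    [MulAction Gᵐᵒᵖ P] where
  proj : P → M
  smooth_act : ContMDiff (𝓘(ℝ, EP).prod 𝓘(ℝ, EG)) 𝓘(ℝ, EP) ∞ (fun x : P × G => op x.2 • x.1)
  smooth_proj : ContMDiff 𝓘(ℝ, EP) 𝓘(ℝ, EM) ∞ proj
  proj_act : ∀ (p : P) (g : G), proj (op g • p) = proj p
  /-- Around every point of `M` there is a smooth equivariant local trivialization. -/
  locally_trivial : ∀ x : M, ∃ e : Bundle.Trivialization G proj, x ∈ e.baseSet ∧
    ContMDiffOn 𝓘(ℝ, EP) (𝓘(ℝ, EM).prod 𝓘(ℝ, EG)) ∞ e e.source ∧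
    ContMDiffOn (𝓘(ℝ, EM).prod 𝓘(ℝ, EG)) 𝓘(ℝ, EP) ∞ e.toOpenPartialHomeomorph.symm e.target ∧
    ∀ (p : P) (g : G), proj p ∈ e.baseSet → e (op g • p) = (proj p, (e p).2 * g)

/-- The adjoint action `Ad_g = T₁(h ↦ g h g⁻¹)` on `𝔤`. -/
def Ad {EG G : Type*} [NormedAddCommGroup EG] [NormedSpace ℝ EG] [TopologicalSpace G]
    [ChartedSpace EG G] [Group G] (g : G) : EG →L[ℝ] EG :=
  mfderiv 𝓘(ℝ, EG) 𝓘(ℝ, EG) (fun h : G => g * h * g⁻¹) (1 : G)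

variable {EG EP EM G P M : Type*}
  [NormedAddCommGroup EG] [NormedSpace ℝ EG] [NormedAddCommGroup EP] [NormedSpace ℝ EP]
  [NormedAddCommGroup EM] [NormedSpace ℝ EM]
  [TopologicalSpace G] [ChartedSpace EG G] [Group G] [LieGroup 𝓘(ℝ, EG) ∞ G]
  [TopologicalSpace P] [ChartedSpace EP P] [IsManifold 𝓘(ℝ, EP) ∞ P]
  [TopologicalSpace M] [ChartedSpace EM M] [IsManifold 𝓘(ℝ, EM) ∞ M]
  [MulAction Gᵐᵒᵖ P] (B : PrincipalBundle EG EP EM G P M)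

namespace PrincipalBundle

theorem smooth_act_right (B : PrincipalBundle EG EP EM G P M) (g : G) :
    ContMDiff 𝓘(ℝ, EP) 𝓘(ℝ, EP) ∞ (fun q : P => op g • q) :=
  B.smooth_act.comp (contMDiff_id.prodMk contMDiff_const)

/-- The infinitesimal generator `ξ ↦ ξ_P(p)`: the derivative at `1` of `h ↦ p · h`. -/
def infGen (_B : PrincipalBundle EG EP EM G P M) (p : P) :
    EG →L[ℝ] TangentSpace 𝓘(ℝ, EP) p :=
  mfderiv 𝓘(ℝ, EG) 𝓘(ℝ, EP) (fun h : G => op h • p) (1 : G)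

/-- `T_p Φ_g`, the derivative of the right translation by `g`. -/
def tAct (_B : PrincipalBundle EG EP EM G P M) (g : G) (p : P) :
    TangentSpace 𝓘(ℝ, EP) p →L[ℝ] TangentSpace 𝓘(ℝ, EP) (op g • p) :=
  mfderiv 𝓘(ℝ, EP) 𝓘(ℝ, EP) (fun q : P => op g • q) p

/-- `T_p π`. -/
def tProj (p : P) : TangentSpace 𝓘(ℝ, EP) p →L[ℝ] TangentSpace 𝓘(ℝ, EM) (B.proj p) :=
  mfderiv 𝓘(ℝ, EP) 𝓘(ℝ, EM) B.proj p

/-- `Conn(P)`: principal connections. -/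
structure Connection extends OneForm EP P EG where
  equivariant : ∀ (g : G) (p : P) (u : TangentSpace 𝓘(ℝ, EP) p),
    toFun (op g • p) (B.tAct g p u) = Ad g⁻¹ (toFun p u)
  reproduces : ∀ (p : P) (ξ : EG), toFun p (B.infGen p ξ) = ξ

/-- Equivariant `𝔤`-valued one-forms on `P` that vanish on vertical vectors. -/
structure HorizontalForm extends OneForm EP P EG where
  equivariant : ∀ (g : G) (p : P) (u : TangentSpace 𝓘(ℝ, EP) p),
    toFun (op g • p) (B.tAct g p u) = Ad g⁻¹ (toFun p u)
  horizontal : ∀ (p : P) (ξ : EG), toFun p (B.infGen p ξ) = 0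

/-- `𝔞𝔲𝔱(P)^* = Ω¹_G(P)`: `G`-invariant one-forms on `P`. -/
structure InvariantForm extends OneForm EP P ℝ where
  invariant : ∀ (g : G) (p : P) (u : TangentSpace 𝓘(ℝ, EP) p),
    toFun (op g • p) (B.tAct g p u) = toFun p u

/-- Smooth maps `f : P → W` with `f (p · g) = r g (f p)`. -/
structure EquivariantMap (_B : PrincipalBundle EG EP EM G P M) (W : Type*) [NormedAddCommGroup W] [NormedSpace ℝ W]
    (r : G → W →L[ℝ] W) where
  toFun : P → W
  smooth : ContMDiff 𝓘(ℝ, EP) 𝓘(ℝ, W) ∞ toFun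
  equivariant : ∀ (p : P) (g : G), toFun (op g • p) = r g (toFun p)

/-- `F_G(P, 𝔤)`: `f ∘ Φ_g = Ad_{g⁻¹} ∘ f`. -/
abbrev AdMap : Type _ := B.EquivariantMap EG (fun g => Ad g⁻¹)

/-- `F_G(P, 𝔤^*)`: `ν ∘ Φ_g = Ad_g^* ∘ ν`, where `Ad_g^*` is the transpose of `Ad_g`. -/
abbrev CoadMap : Type _ :=
  B.EquivariantMap (EG →L[ℝ] ℝ)
    (fun g => (ContinuousLinearMap.compL ℝ EG EG ℝ).flip (Ad g))

/-- `𝔞𝔲𝔱(P)`: `G`-invariant smooth vector fields on `P`. -/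
structure InvariantField where
  toFun : ∀ p : P, TangentSpace 𝓘(ℝ, EP) p
  smooth : ContMDiff 𝓘(ℝ, EP) 𝓘(ℝ, EP).tangent ∞
    (fun p => (⟨p, toFun p⟩ : TangentBundle 𝓘(ℝ, EP) P))
  invariant : ∀ (g : G) (p : P), toFun (op g • p) = B.tAct g p (toFun p)

/-- `𝔤𝔞𝔲(P)`: `G`-invariant vertical vector fields on `P`. -/
structure GaugeField extends InvariantField B where
  vertical : ∀ p, B.tProj p (toFun p) = 0

instance : DiffeologicalSpace B.Connection := inducedDiffeology Connection.toOneForm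

instance : DiffeologicalSpace B.HorizontalForm := inducedDiffeology HorizontalForm.toOneForm

instance : DiffeologicalSpace B.InvariantForm := inducedDiffeology InvariantForm.toOneForm

instance (W : Type*) [NormedAddCommGroup W] [NormedSpace ℝ W] (r : G → W →L[ℝ] W) :
    DiffeologicalSpace (B.EquivariantMap W r) :=
  functionalDiffeology 𝓘(ℝ, EP) (fun (f : B.EquivariantMap W r) (p : P) => f.toFun p)
    (fun f => f.smooth)

/-! ### The phase spaces -/

/-- `T^*Conn(P)`: `Conn(P)` is affine over the space of horizontal equivariant forms, and cotangent
vectors are identified with tangent vectors by the `L²` pairing. -/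
abbrev CotangentConn : Type _ := B.Connection × B.HorizontalForm

/-- `𝔰^*` for `𝔰 = 𝔞𝔲𝔱(P) ⋉ (F(M) × F(M))`. -/
abbrev SDual : Type _ := B.InvariantForm × SmoothFun EM M × SmoothFun EM M

/-- `𝔨^*` for `𝔨 = 𝔛(M) ⋉ (F(M) × F(M))`. -/
abbrev KDual (_B : PrincipalBundle EG EP EM G P M) : Type _ :=
  OneForm EM M ℝ × SmoothFun EM M × SmoothFun EM M

/-! ### Gauge transformations -/

/-- `Gau(P)`: equivariant diffeomorphisms of `P` over the identity of `M`. -/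
structure Gauge (B : PrincipalBundle EG EP EM G P M) where
  toDiffeo : P ≃ₘ^∞⟮𝓘(ℝ, EP), 𝓘(ℝ, EP)⟯ P
  equivariant : ∀ (p : P) (g : G), toDiffeo (op g • p) = op g • toDiffeo p
  over_id : ∀ p, B.proj (toDiffeo p) = B.proj p

variable {B}

theorem Gauge.mfderiv_tAct (η : B.Gauge) (g : G) (p : P) (u : TangentSpace 𝓘(ℝ, EP) p) :
    (mfderiv 𝓘(ℝ, EP) 𝓘(ℝ, EP) η.toDiffeo (op g • p) (B.tAct g p u) : EP) =
      B.tAct g (η.toDiffeo p) (mfderiv 𝓘(ℝ, EP) 𝓘(ℝ, EP) η.toDiffeo p u) := by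
  have h1 : MDifferentiable 𝓘(ℝ, EP) 𝓘(ℝ, EP) η.toDiffeo :=
    η.toDiffeo.contMDiff.mdifferentiable (by simp)
  have h2 : MDifferentiable 𝓘(ℝ, EP) 𝓘(ℝ, EP) (fun q : P => op g • q) :=
    (B.smooth_act_right g).mdifferentiable (by simp)
  have e : η.toDiffeo ∘ (fun q : P => op g • q) = (fun q : P => op g • q) ∘ η.toDiffeo := by
    funext q
    exact η.equivariant q g
  have a1 := mfderiv_comp_apply p (h1 (op g • p)) (h2 p) u
  have a2 := mfderiv_comp_apply p (h2 (η.toDiffeo p)) (h1 p) u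
  rw [e] at a1
  exact a1.symm.trans a2

theorem Gauge.mfderiv_infGen (η : B.Gauge) (p : P) (ξ : EG) :
    (mfderiv 𝓘(ℝ, EP) 𝓘(ℝ, EP) η.toDiffeo p (B.infGen p ξ) : EP) =
      B.infGen (η.toDiffeo p) ξ := by
  have h1 : MDifferentiable 𝓘(ℝ, EP) 𝓘(ℝ, EP) η.toDiffeo :=
    η.toDiffeo.contMDiff.mdifferentiable (by simp)
  have h2 : MDifferentiable 𝓘(ℝ, EG) 𝓘(ℝ, EP) (fun h : G => op h • p) :=
    (B.smooth_act.comp (contMDiff_const.prodMk contMDiff_id)).mdifferentiable (by simp)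
  have e : η.toDiffeo ∘ (fun h : G => op h • p) = fun h : G => op h • η.toDiffeo p := by
    funext h
    exact η.equivariant p h
  have a1 := mfderiv_comp_apply (1 : G) (h1 (op (1 : G) • p)) (h2 1) ξ
  rw [e] at a1
  have key : ∀ (q : P) (v : EP), q = p →
      (mfderiv 𝓘(ℝ, EP) 𝓘(ℝ, EP) η.toDiffeo q v : EP) =
        mfderiv 𝓘(ℝ, EP) 𝓘(ℝ, EP) η.toDiffeo p v := by
    intro q v h
    subst h
    rfl
  exact (key (op (1 : G) • p) (B.infGen p ξ) (by simp)).symm.trans a1.symm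

/-- The pull-back `η^*A` of a connection. -/
def Connection.pullback (η : B.Gauge) (A : B.Connection) : B.Connection where
  toOneForm := A.toOneForm.pullback η.toDiffeo
  equivariant g p u := by
    exact (A.toOneForm.congr_point (η.equivariant p g) (η.mfderiv_tAct g p u)).trans
      (A.equivariant g _ _)
  reproduces p ξ := by
    exact (A.toOneForm.congr_point rfl (η.mfderiv_infGen p ξ)).trans (A.reproduces _ _)

/-- The pull-back `η^*Y` of a horizontal equivariant form. -/
def HorizontalForm.pullback (η : B.Gauge) (Y : B.HorizontalForm) : B.HorizontalForm where
  toOneForm := Y.toOneForm.pullback η.toDiffeo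
  equivariant g p u := by
    exact (Y.toOneForm.congr_point (η.equivariant p g) (η.mfderiv_tAct g p u)).trans
      (Y.equivariant g _ _)
  horizontal p ξ := by
    exact (Y.toOneForm.congr_point rfl (η.mfderiv_infGen p ξ)).trans (Y.horizontal _ _)

/-- The form `-Y`. -/
def HorizontalForm.neg (Y : B.HorizontalForm) : B.HorizontalForm where
  toOneForm := Y.toOneForm.neg
  equivariant g p u := by
    change -(Y.toFun (op g • p) (B.tAct g p u)) = Ad g⁻¹ (-(Y.toFun p u))
    rw [Y.equivariant, map_neg]
  horizontal p ξ := by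
    change -(Y.toFun p (B.infGen p ξ)) = 0
    rw [Y.horizontal, neg_zero]

/-- The coadjoint action `Ad^*_η M` of a gauge transformation on `𝔞𝔲𝔱(P)^*`.  Since
`Ad_η U = Tη ∘ U ∘ η⁻¹` and `η` covers the identity of `M`, the transpose of `Ad_η` is the pull-back
`M ↦ η^*M`. -/
def InvariantForm.coad (η : B.Gauge) (m : B.InvariantForm) : B.InvariantForm where
  toOneForm := m.toOneForm.pullback η.toDiffeo
  invariant g p u := by
    exact (m.toOneForm.congr_point (η.equivariant p g) (η.mfderiv_tAct g p u)).trans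
      (m.invariant g _ _)

/-- The map `ν ∘ η`. -/
def CoadMap.comp (ν : B.CoadMap) (η : B.Gauge) : B.CoadMap where
  toFun p := ν.toFun (η.toDiffeo p)
  smooth := ν.smooth.comp η.toDiffeo.contMDiff
  equivariant p g := by rw [η.equivariant, ν.equivariant]

/-- The gauge action `(M, ρ, s, A, Y) ↦ (Ad^*_η M, ρ, s, η^*A, η^*Y)` on `𝔰^* × T^*Conn(P)`. -/
def gaugeAct (η : B.Gauge) (z : B.SDual × B.CotangentConn) : B.SDual × B.CotangentConn :=
  ((z.1.1.coad η, z.1.2.1, z.1.2.2), (z.2.1.pullback η, z.2.2.pullback η))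

/-- The gauge action `(n, ρ, s, ν, A, E) ↦ (n, ρ, s, ν ∘ η, η^*A, η^*E)` on
`𝔨^* × F_G(P, 𝔤^*) × T^*Conn(P)`. -/
def gaugeAct' (η : B.Gauge) (w : B.KDual × B.CoadMap × B.CotangentConn) :
    B.KDual × B.CoadMap × B.CotangentConn :=
  (w.1, CoadMap.comp w.2.1 η, (w.2.2.1.pullback η, w.2.2.2.pullback η))

/-! ### Horizontal lifts, the covariant codifferential and the momentum map -/

/-- The horizontal lift `Hor_A(p) : T_{π(p)}M → T_pP`: the restriction to the first factor of the
inverse of the isomorphism `(T_pπ, A(p)) : T_pP → T_{π(p)}M × 𝔤`. -/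
def Connection.hor (A : B.Connection) (p : P) :
    TangentSpace 𝓘(ℝ, EM) (B.proj p) →L[ℝ] TangentSpace 𝓘(ℝ, EP) p :=
  (ContinuousLinearMap.inverse ((B.tProj p).prod (A.toFun p))).comp
    (ContinuousLinearMap.inl ℝ (TangentSpace 𝓘(ℝ, EM) (B.proj p)) EG)

/-- Smooth Riemannian metrics on `M`. -/
abbrev Metric (EM M : Type*) [NormedAddCommGroup EM] [NormedSpace ℝ EM]
    [TopologicalSpace M] [ChartedSpace EM M] [IsManifold 𝓘(ℝ, EM) ∞ M] : Type _ :=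
  Bundle.ContMDiffRiemannianMetric 𝓘(ℝ, EM) ∞ EM (fun x : M => TangentSpace 𝓘(ℝ, EM) x)

/-- `Ad`-invariant inner products on `𝔤`. -/
structure AdInvariantInner (EG G : Type*) [NormedAddCommGroup EG] [NormedSpace ℝ EG]
    [TopologicalSpace G] [ChartedSpace EG G] [Group G] where
  form : EG →L[ℝ] EG →L[ℝ] ℝ
  symm : ∀ ξ ζ, form ξ ζ = form ζ ξ
  pos : ∀ ξ, ξ ≠ 0 → 0 < form ξ ξ
  invariant : ∀ (g : G) (ξ ζ : EG), form (Ad g ξ) (Ad g ζ) = form ξ ζ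

section Codifferential

variable [FiniteDimensional ℝ EM]

/-- The coordinate vector fields `∂_i` of the chart of `M` centred at `c` (with respect to a fixed
basis of the model space), at points `x` of the domain of the chart. -/
def coordField (c : M) (i : Fin (Module.finrank ℝ EM)) (x : M) : TangentSpace 𝓘(ℝ, EM) x :=
  (mfderiv 𝓘(ℝ, EM) 𝓘(ℝ, EM) (extChartAt 𝓘(ℝ, EM) c).symm (extChartAt 𝓘(ℝ, EM) c x)
    (Module.finBasis ℝ EM i) : EM)

/-- The matrix `g_ij = g(∂_i, ∂_j)` in the chart centred at `c`. -/
def gram (g : Metric EM M) (c x : M) :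
    Matrix (Fin (Module.finrank ℝ EM)) (Fin (Module.finrank ℝ EM)) ℝ :=
  Matrix.of fun i j => g.inner x (coordField c i x) (coordField c j x)

/-- The covariant codifferential `δ^A Y : P → 𝔤` of a horizontal equivariant one-form, by the
classical formula
`δ^A Y = - |g|^{-1/2} ∑_{i,j} ∇^A_i (|g|^{1/2} g^{ij} Y_j)`
in the chart of `M` centred at `π(p)`.  Here `Y_j = Y(Hor_A ∂_j)` is regarded as an equivariant
function on `P`, and `∇^A_i` is the derivative along the horizontal lift of `∂_i`.  This is the
formal adjoint of `d^A` for the `L²` pairings given by `g` and `γ`. -/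
def codiff (g : Metric EM M) (A : B.Connection) (Y : B.HorizontalForm) (p : P) : EG :=
  -∑ i, (Real.sqrt (gram g (B.proj p) (B.proj p)).det)⁻¹ •
    (mfderiv 𝓘(ℝ, EP) 𝓘(ℝ, EG)
      (fun q : P => ∑ j, (Real.sqrt (gram g (B.proj p) (B.proj q)).det *
        (gram g (B.proj p) (B.proj q))⁻¹ i j) •
          Y.toFun q (A.hor q (coordField (B.proj p) j (B.proj q)))) p
      (A.hor p (coordField (B.proj p) i (B.proj p))) : EG)

/-- The Kaluza-Klein metric `K_A(u, v) = g(Tπ u, Tπ v) + γ(A u, A v)` on `P`. -/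
def kaluzaKlein (g : Metric EM M) (γ : AdInvariantInner EG G) (A : B.Connection) (p : P)
    (u v : TangentSpace 𝓘(ℝ, EP) p) : ℝ :=
  g.inner (B.proj p) (B.tProj p u) (B.tProj p v) + γ.form (A.toFun p u) (A.toFun p v)

/-- `σ(f) = N`, i.e. `N(p) = f(p)_P(p)` for all `p`. -/
def IsSigma (f : P → EG) (N : B.GaugeField) : Prop :=
  ∀ p, B.infGen p (f p) = N.toFun p

/-- The level set `J⁻¹(N) ⊆ 𝔰^* × T^*Conn(P)` of the gauge momentum map
`J(M, ρ, s, A, Y) = σ(δ^A Y - A(V))`, where `V ∈ 𝔞𝔲𝔱(P)` is the field with `M = K_A(V, ·)`. -/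
def momentumLevel (g : Metric EM M) (γ : AdInvariantInner EG G) (N : B.GaugeField) :
    Set (B.SDual × B.CotangentConn) :=
  {z | ∃ V : B.InvariantField,
    (∀ p u, z.1.1.toFun p u = kaluzaKlein g γ z.2.1 p (V.toFun p) u) ∧
    IsSigma (fun p => codiff g z.2.1 z.2.2 p - z.2.1.toFun p (V.toFun p)) N}

end Codifferential

end PrincipalBundle

end Bundle

end EYM

end

open EYM EYM.PrincipalBundle

/-! A connection `A` identifies T_pP with T_{π(p)}M × 𝔤 through (Tπ, A), the inverse being (v, ξ) ↦
Hor_A v + ξ_P. Dually, an invariant one-form m is determined by its values on horizontal and on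
vertical vectors. The horizontal part n = Hor_A^* ∘ m descends to M because both m and the
horizontal lifts are G-invariant; the vertical part ν = 𝕁 ∘ m is an equivariant map. Conversely m =
π^*n + ν(A), which is `InvariantForm.ofParts`. Both directions preserve joint smoothness in
parameters. The delicate ingredient is Hor_A, whose definition involves an inverse: locally it is
any smooth lift with its vertical part removed (`contMDiffAt_hor`). Gauge equivariance holds because
Tη carries η^*A-horizontal lifts to A-horizontal lifts and generators to generators.

For the level set, write m = K_A(V, ·). Pairing with generators gives ν = γ(A(V), ·), so σ(δ^A Y -
A(V)) = N becomes ν + γ(δ^A(-Y) + A(N), ·) = 0, where A(N) = f if N = σ(f). Each m does have such a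
V (`exists_invariantField`). Hence i(J⁻¹(N)) is the graph of (A, E) ↦ -γ(δ^A E + A(N), ·) over the
variables other than ν. Forgetting ν is therefore a diffeomorphism as soon as δ^A E is a smooth
equivariant function depending smoothly on A and E.

This last point is the analytic core. `codiff` uses the chart centred at π(p), which changes with p,
so smoothness requires independence of the chart. The components √|g| g^{ij} Y_j form a vector
density: under a change of chart with Jacobian a they are multiplied by |det a| a⁻¹, which is the
adjugate of a up to a locally constant sign. Piola's identity, a consequence of the symmetry of
second derivatives, removes the derivatives of the adjugate (`sum_fderiv_eq_of_change`,
`codiffIn_eq_codiffIn`). Near p one may then compute in one fixed chart (`contMDiff_codiff_family`).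
-/

namespace EYM

/-! ### Smooth families of tangent vectors -/

section TangentCalculus

variable {EW HW W E N E' N' V : Type*} [NormedAddCommGroup EW] [NormedSpace ℝ EW]
  [TopologicalSpace HW] {J : ModelWithCorners ℝ EW HW} [TopologicalSpace W] [ChartedSpace HW W]
  [NormedAddCommGroup E] [NormedSpace ℝ E] [TopologicalSpace N] [ChartedSpace E N]
  [IsManifold 𝓘(ℝ, E) ∞ N]
  [NormedAddCommGroup E'] [NormedSpace ℝ E'] [TopologicalSpace N'] [ChartedSpace E' N']
  [IsManifold 𝓘(ℝ, E') ∞ N'] [NormedAddCommGroup V] [NormedSpace ℝ V]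

/-- The partial derivative of a smooth family of maps, applied to a smooth family of tangent
vectors, is a smooth family of tangent vectors. -/
theorem contMDiffAt_mfderiv_family [IsManifold J ∞ W] {φ : W → N → N'} {b : W → N}
    {v : ∀ w, TangentSpace 𝓘(ℝ, E) (b w)} {w₀ : W}
    (hφ : ContMDiffAt (J.prod 𝓘(ℝ, E)) 𝓘(ℝ, E') ∞ (Function.uncurry φ) (w₀, b w₀))
    (hv : ContMDiffAt J 𝓘(ℝ, E).tangent ∞
      (fun w => (⟨b w, v w⟩ : TangentBundle 𝓘(ℝ, E) N)) w₀) :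
    ContMDiffAt J 𝓘(ℝ, E').tangent ∞
      (fun w => (⟨φ w (b w), mfderiv 𝓘(ℝ, E) 𝓘(ℝ, E') (φ w) (b w) (v w)⟩ :
        TangentBundle 𝓘(ℝ, E') N')) w₀ := by
  have hb : ContMDiffAt J 𝓘(ℝ, E) ∞ b w₀ := (Bundle.contMDiffAt_totalSpace.1 hv).1
  -- The derivative is smooth when read in fixed trivializations of the two tangent bundles;
  -- evaluating it there on a smooth vector gives a smooth vector.
  have h1 := ContMDiffAt.mfderiv (m := ∞) (n := ∞) φ b hφ hb le_rfl
  have h2 : ContMDiffAt J 𝓘(ℝ, E') ∞ (fun w => φ w (b w)) w₀ :=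
    hφ.comp w₀ (contMDiffAt_id.prodMk hb)
  exact ContMDiffAt.clm_apply_of_inCoordinates h1 hv h2

/-- The vector-valued version of `contMDiffAt_mfderiv_family`. -/
theorem contMDiffAt_mfderiv_family_vector [IsManifold J ∞ W] {φ : W → N → V} {b : W → N}
    {v : ∀ w, TangentSpace 𝓘(ℝ, E) (b w)} {w₀ : W}
    (hφ : ContMDiffAt (J.prod 𝓘(ℝ, E)) 𝓘(ℝ, V) ∞ (Function.uncurry φ) (w₀, b w₀))
    (hv : ContMDiffAt J 𝓘(ℝ, E).tangent ∞
      (fun w => (⟨b w, v w⟩ : TangentBundle 𝓘(ℝ, E) N)) w₀) :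
    ContMDiffAt J 𝓘(ℝ, V) ∞
      (fun w => (mfderiv 𝓘(ℝ, E) 𝓘(ℝ, V) (φ w) (b w) (v w) : V)) w₀ :=
  (contMDiff_snd_tangentBundle_modelSpace V 𝓘(ℝ, V)).contMDiffAt.comp w₀
    (contMDiffAt_mfderiv_family hφ hv)

/-- Over a fixed base point the trivialization centred there acts on the fibre as a coordinate
change from a chart to itself, hence as the identity. -/
theorem contMDiffAt_tangentVector_const {b : N} {ξ : W → E} {w₀ : W}
    (hξ : ContMDiffAt J 𝓘(ℝ, E) ∞ ξ w₀) :
    ContMDiffAt J 𝓘(ℝ, E).tangent ∞ (fun w => (⟨b, ξ w⟩ : TangentBundle 𝓘(ℝ, E) N)) w₀ := by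
  refine Bundle.contMDiffAt_totalSpace.2 ⟨contMDiffAt_const, ?_⟩
  refine hξ.congr_of_eventuallyEq (Filter.Eventually.of_forall fun w => ?_)
  exact (tangentBundleCore 𝓘(ℝ, E) N).coordChange_self (achart E b) b (mem_achart_source E b) (ξ w)

omit [IsManifold 𝓘(ℝ, E) ∞ N] in
/-- Two tangent vectors over equal points with the same model vector are equal. -/
theorem tangentBundle_mk_eq {x y : N} {v w : E} (h : x = y) (h' : v = w) :
    (⟨x, v⟩ : TangentBundle 𝓘(ℝ, E) N) = ⟨y, w⟩ := by
  subst h h'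
  rfl

theorem contMDiffAt_tangentVector_add {b : W → N} {v v' : ∀ w, TangentSpace 𝓘(ℝ, E) (b w)} {w₀ : W}
    (hv : ContMDiffAt J 𝓘(ℝ, E).tangent ∞
      (fun w => (⟨b w, v w⟩ : TangentBundle 𝓘(ℝ, E) N)) w₀)
    (hv' : ContMDiffAt J 𝓘(ℝ, E).tangent ∞
      (fun w => (⟨b w, v' w⟩ : TangentBundle 𝓘(ℝ, E) N)) w₀) :
    ContMDiffAt J 𝓘(ℝ, E).tangent ∞
      (fun w => (⟨b w, v w + v' w⟩ : TangentBundle 𝓘(ℝ, E) N)) w₀ := by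
  rw [Bundle.contMDiffAt_totalSpace] at hv hv' ⊢
  refine ⟨hv.1, (hv.2.add hv'.2).congr_of_eventuallyEq ?_⟩
  have h : ∀ᶠ w in nhds w₀, b w ∈ (trivializationAt E (TangentSpace 𝓘(ℝ, E)) (b w₀)).baseSet :=
    hv.1.continuousAt.preimage_mem_nhds
      ((trivializationAt E (TangentSpace 𝓘(ℝ, E)) (b w₀)).open_baseSet.mem_nhds
        (FiberBundle.mem_baseSet_trivializationAt' (b w₀)))
  filter_upwards [h] with w hw
  exact ((trivializationAt E (TangentSpace 𝓘(ℝ, E)) (b w₀)).linear ℝ hw).map_add _ _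

theorem contMDiffAt_tangentVector_smul {b : W → N} {v : ∀ w, TangentSpace 𝓘(ℝ, E) (b w)}
    {a : W → ℝ} {w₀ : W} (ha : ContMDiffAt J 𝓘(ℝ, ℝ) ∞ a w₀)
    (hv : ContMDiffAt J 𝓘(ℝ, E).tangent ∞
      (fun w => (⟨b w, v w⟩ : TangentBundle 𝓘(ℝ, E) N)) w₀) :
    ContMDiffAt J 𝓘(ℝ, E).tangent ∞
      (fun w => (⟨b w, a w • v w⟩ : TangentBundle 𝓘(ℝ, E) N)) w₀ := by
  rw [Bundle.contMDiffAt_totalSpace] at hv ⊢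
  refine ⟨hv.1, (ha.smul hv.2).congr_of_eventuallyEq ?_⟩
  have h : ∀ᶠ w in nhds w₀, b w ∈ (trivializationAt E (TangentSpace 𝓘(ℝ, E)) (b w₀)).baseSet :=
    hv.1.continuousAt.preimage_mem_nhds
      ((trivializationAt E (TangentSpace 𝓘(ℝ, E)) (b w₀)).open_baseSet.mem_nhds
        (FiberBundle.mem_baseSet_trivializationAt' (b w₀)))
  filter_upwards [h] with w hw
  exact ((trivializationAt E (TangentSpace 𝓘(ℝ, E)) (b w₀)).linear ℝ hw).map_smul _ _

theorem contMDiffAt_tangentVector_zero {b : W → N} {w₀ : W}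
    (hb : ContMDiffAt J 𝓘(ℝ, E) ∞ b w₀) :
    ContMDiffAt J 𝓘(ℝ, E).tangent ∞
      (fun w => (⟨b w, 0⟩ : TangentBundle 𝓘(ℝ, E) N)) w₀ :=
  (Bundle.contMDiff_zeroSection ℝ (TangentSpace 𝓘(ℝ, E) : N → Type _)).contMDiffAt.comp w₀ hb

theorem contMDiffAt_tangentVector_sum {ι : Type*} (s : Finset ι) {b : W → N}
    {v : ι → ∀ w, TangentSpace 𝓘(ℝ, E) (b w)} {w₀ : W}
    (hb : ContMDiffAt J 𝓘(ℝ, E) ∞ b w₀)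
    (hv : ∀ i ∈ s, ContMDiffAt J 𝓘(ℝ, E).tangent ∞
      (fun w => (⟨b w, v i w⟩ : TangentBundle 𝓘(ℝ, E) N)) w₀) :
    ContMDiffAt J 𝓘(ℝ, E).tangent ∞
      (fun w => (⟨b w, ∑ i ∈ s, v i w⟩ : TangentBundle 𝓘(ℝ, E) N)) w₀ := by
  classical
  induction s using Finset.induction_on with
  | empty => simpa using contMDiffAt_tangentVector_zero hb
  | insert i s hi ih =>
    simp only [Finset.sum_insert hi]
    exact contMDiffAt_tangentVector_add (hv i (by simp))
      (ih fun j hj => hv j (by simp [hj]))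

/-- A map into the dual of a finite-dimensional space is smooth if all its evaluations are. -/
theorem contMDiffAt_dual_of_apply [FiniteDimensional ℝ V] {f : W → V →L[ℝ] ℝ} {w₀ : W}
    (h : ∀ ξ, ContMDiffAt J 𝓘(ℝ, ℝ) ∞ (fun w => f w ξ) w₀) :
    ContMDiffAt J 𝓘(ℝ, V →L[ℝ] ℝ) ∞ f w₀ := by
  let b := Module.finBasis ℝ V
  have e : f = fun w => ∑ i, f w (b i) • (b.coord i).toContinuousLinearMap := by
    funext w
    ext ξ
    conv_lhs => rw [← b.sum_repr ξ, map_sum]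
    simp [mul_comm]
  rw [e]
  exact contMDiffAt_finsetSum fun i _ => (h (b i)).smul contMDiffAt_const

end TangentCalculus

end EYM

namespace EYM.PrincipalBundle

variable {EG EP EM G P M : Type*}
  [NormedAddCommGroup EG] [NormedSpace ℝ EG] [NormedAddCommGroup EP] [NormedSpace ℝ EP]
  [NormedAddCommGroup EM] [NormedSpace ℝ EM]
  [TopologicalSpace G] [ChartedSpace EG G] [Group G] [LieGroup 𝓘(ℝ, EG) ∞ G]
  [TopologicalSpace P] [ChartedSpace EP P] [IsManifold 𝓘(ℝ, EP) ∞ P]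
  [TopologicalSpace M] [ChartedSpace EM M] [IsManifold 𝓘(ℝ, EM) ∞ M]
  [MulAction Gᵐᵒᵖ P]

/-! ### Local sections and vertical vectors of a principal bundle -/

section LocalStructure

variable (B : PrincipalBundle EG EP EM G P M)

/-- A smooth local section `sec` of a principal bundle, together with the group-valued function
`coord` expressing points of the bundle in terms of it. -/
structure LocalSection where
  base : Set M
  isOpen_base : IsOpen base
  sec : M → P
  coord : P → G
  contMDiffOn_sec : ContMDiffOn 𝓘(ℝ, EM) 𝓘(ℝ, EP) ∞ sec base
  contMDiffOn_coord : ContMDiffOn 𝓘(ℝ, EP) 𝓘(ℝ, EG) ∞ coord (B.proj ⁻¹' base)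
  proj_sec : ∀ x ∈ base, B.proj (sec x) = x
  coord_smul_sec : ∀ q, B.proj q ∈ base → op (coord q) • sec (B.proj q) = q

/-- In an equivariant trivialization, take the section with constant group component equal to that
of `p`. This normalization makes it pass through `p` and gives `p` the coordinate `1`, so that
derivatives in the group direction at `p` are taken at the identity. -/
theorem exists_localSection (p : P) : ∃ s : B.LocalSection,
    B.proj p ∈ s.base ∧ s.sec (B.proj p) = p ∧ s.coord p = 1 := by
  obtain ⟨e, hx, he, he', hact⟩ := B.locally_trivial (B.proj p)
  have hsrc : e.source = B.proj ⁻¹' e.baseSet := e.source_eq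
  have hmem : ∀ (x : M) (a : G), x ∈ e.baseSet → (x, a) ∈ e.target := fun x a h => by
    rw [e.target_eq]
    exact ⟨h, trivial⟩
  have hproj : ∀ (x : M) (a : G), x ∈ e.baseSet →
      B.proj (e.toOpenPartialHomeomorph.symm (x, a)) = x := fun x a h =>
    e.proj_symm_apply (hmem x a h)
  refine ⟨⟨e.baseSet, e.open_baseSet, fun x => e.toOpenPartialHomeomorph.symm (x, (e p).2),
    fun q => (e p).2⁻¹ * (e q).2, ?_, ?_, fun x h => hproj x _ h, ?_⟩, hx, ?_, ?_⟩
  · exact he'.comp (contMDiffOn_id.prodMk contMDiffOn_const) fun x h => hmem x _ h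
  · rw [← hsrc]
    exact contMDiffOn_const.mul (contMDiff_snd.comp_contMDiffOn he)
  · intro q hq
    apply e.injOn
    · rw [hsrc, Set.mem_preimage, B.proj_act, hproj _ _ hq]
      exact hq
    · rwa [hsrc]
    · have h := e.apply_symm_apply (hmem (B.proj q) (e p).2 hq)
      refine (hact _ _ (by rwa [hproj _ _ hq])).trans ?_
      rw [h, hproj _ _ hq, mul_inv_cancel_left]
      exact e.mk_proj_snd' hq
  · change e.toOpenPartialHomeomorph.symm (B.proj p, (e p).2) = p
    rw [e.mk_proj_snd' hx]
    exact e.toOpenPartialHomeomorph.left_inv (by rwa [hsrc])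
  · exact inv_mul_cancel _

theorem proj_surjective : Function.Surjective B.proj := fun x => by
  obtain ⟨e, hx, -⟩ := B.locally_trivial x
  exact ⟨_, e.proj_symm_apply (x := (x, 1)) (by rw [e.target_eq]; exact ⟨hx, trivial⟩)⟩

theorem exists_smul_eq_of_proj_eq {p q : P} (h : B.proj p = B.proj q) :
    ∃ g : G, op g • p = q := by
  obtain ⟨s, hs, hp, -⟩ := B.exists_localSection p
  refine ⟨s.coord q, ?_⟩
  have := s.coord_smul_sec q (by rwa [← h])
  rwa [← h, hp] at this

variable {B}

theorem LocalSection.contMDiffAt_sec (s : B.LocalSection) {x : M} (h : x ∈ s.base) :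
    ContMDiffAt 𝓘(ℝ, EM) 𝓘(ℝ, EP) ∞ s.sec x :=
  s.contMDiffOn_sec.contMDiffAt (s.isOpen_base.mem_nhds h)

theorem LocalSection.preimage_base_mem_nhds (s : B.LocalSection) {p : P} (h : B.proj p ∈ s.base) :
    B.proj ⁻¹' s.base ∈ nhds p :=
  (s.isOpen_base.preimage B.smooth_proj.continuous).mem_nhds h

theorem LocalSection.contMDiffAt_coord (s : B.LocalSection) {p : P} (h : B.proj p ∈ s.base) :
    ContMDiffAt 𝓘(ℝ, EP) 𝓘(ℝ, EG) ∞ s.coord p :=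
  s.contMDiffOn_coord.contMDiffAt (s.preimage_base_mem_nhds h)

variable (B)

theorem contMDiff_orbit (B : PrincipalBundle EG EP EM G P M) (p : P) : ContMDiff 𝓘(ℝ, EG) 𝓘(ℝ, EP) ∞ (fun h : G => op h • p) :=
  B.smooth_act.comp (contMDiff_const.prodMk contMDiff_id)

theorem tProj_congr {p q : P} {u v : EP} (h : p = q) (h' : u = v) :
    (B.tProj p u : EM) = B.tProj q v := by
  subst h h'
  rfl

/-- Orbits lie in fibres, so the projection is constant along them. -/
theorem tProj_infGen (p : P) (ξ : EG) : B.tProj p (B.infGen p ξ) = 0 := by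
  have h1 := mfderiv_comp_apply (1 : G)
    (B.smooth_proj.mdifferentiable (by simp) (op (1 : G) • p))
    ((B.contMDiff_orbit p).mdifferentiable (by simp) 1) ξ
  have h2 : B.proj ∘ (fun h : G => op h • p) = fun _ => B.proj p := funext fun h => B.proj_act p h
  rw [h2, mfderiv_const] at h1
  exact (B.tProj_congr (by simp : p = op (1 : G) • p) rfl).trans h1.symm

theorem tProj_tAct (g : G) (p : P) (u : TangentSpace 𝓘(ℝ, EP) p) :
    (B.tProj (op g • p) (B.tAct g p u) : EM) = B.tProj p u := by
  have h1 := mfderiv_comp_apply p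
    (B.smooth_proj.mdifferentiable (by simp) (op g • p))
    ((B.smooth_act_right g).mdifferentiable (by simp) p) u
  have h2 : B.proj ∘ (fun q : P => op g • q) = B.proj := funext fun q => B.proj_act q g
  rw [h2] at h1
  exact h1.symm

theorem tAct_tAct_inv (g : G) (p : P) (u : TangentSpace 𝓘(ℝ, EP) (op g • p)) :
    (B.tAct g (op g⁻¹ • op g • p) (B.tAct g⁻¹ (op g • p) u) : EP) = u := by
  have h1 := mfderiv_comp_apply (op g • p)
    ((B.smooth_act_right g).mdifferentiable (by simp) (op g⁻¹ • op g • p))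
    ((B.smooth_act_right g⁻¹).mdifferentiable (by simp) (op g • p)) u
  have h2 : (fun q : P => op g • q) ∘ (fun q : P => op g⁻¹ • q) = id := funext fun q => by
    simp [smul_smul]
  rw [h2, mfderiv_id] at h1
  exact h1.symm

theorem tAct_congr (g : G) {p q : P} {u v : EP} (h : p = q) (h' : u = v) :
    (B.tAct g p u : EP) = B.tAct g q v := by
  subst h h'
  rfl

theorem tAct_surjective (g : G) (p : P) : Function.Surjective (B.tAct g p) := fun u =>
  ⟨(B.tAct g⁻¹ (op g • p) u : EP), (B.tAct_congr g (by simp : p = op g⁻¹ • op g • p) rfl).trans (B.tAct_tAct_inv g p u)⟩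

/-- The derivative of a local section through `p` is a right inverse of T_pπ. -/
theorem tProj_surjective (p : P) : Function.Surjective (B.tProj p) := fun v => by
  obtain ⟨s, hs, hp, -⟩ := B.exists_localSection p
  have h1 := mfderiv_comp_apply (B.proj p)
    (B.smooth_proj.mdifferentiable (by simp) (s.sec (B.proj p)))
    ((s.contMDiffAt_sec hs).mdifferentiableAt (by simp)) v
  have h2 : B.proj ∘ s.sec =ᶠ[nhds (B.proj p)] id := by
    filter_upwards [s.isOpen_base.mem_nhds hs] with x hx using s.proj_sec x hx
  rw [h2.mfderiv_eq, mfderiv_id] at h1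
  exact ⟨(mfderiv 𝓘(ℝ, EM) 𝓘(ℝ, EP) s.sec (B.proj p) v : EP),
    (B.tProj_congr hp.symm rfl).trans h1.symm⟩

/-- Differentiate `q = sec (π q) · coord q` at `p` along `u`. The section term sees only Tπ u = 0,
so `u` comes entirely from the group variable: it is generated by the derivative of `coord` along
`u`. -/
theorem exists_infGen_eq {p : P} {u : TangentSpace 𝓘(ℝ, EP) p} (hu : B.tProj p u = 0) :
    ∃ ξ : EG, B.infGen p ξ = u := by
  obtain ⟨s, hs, hp, hk⟩ := B.exists_localSection p
  let act : P × G → P := fun x => op x.2 • x.1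
  let f : P → P × G := fun q => (s.sec (B.proj q), s.coord q)
  have hr : MDifferentiableAt 𝓘(ℝ, EP) 𝓘(ℝ, EP) (fun q => s.sec (B.proj q)) p :=
    ((s.contMDiffAt_sec hs).comp p B.smooth_proj.contMDiffAt).mdifferentiableAt (by simp)
  have hk' : MDifferentiableAt 𝓘(ℝ, EP) 𝓘(ℝ, EG) s.coord p :=
    (s.contMDiffAt_coord hs).mdifferentiableAt (by simp)
  have hact : MDifferentiableAt (𝓘(ℝ, EP).prod 𝓘(ℝ, EG)) 𝓘(ℝ, EP) act (f p) :=
    B.smooth_act.mdifferentiable (by simp) _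
  have h2 : act ∘ f =ᶠ[nhds p] id := by
    filter_upwards [s.preimage_base_mem_nhds hs] with q hq using s.coord_smul_sec q hq
  have h3 := mfderiv_comp_apply p ((s.contMDiffAt_sec hs).mdifferentiableAt (by simp))
    (B.smooth_proj.mdifferentiable (by simp) p) u
  have h4 : (mfderiv 𝓘(ℝ, EP) 𝓘(ℝ, EP) (fun q => s.sec (B.proj q)) p u : EP) = 0 := by
    refine h3.trans ?_
    change mfderiv 𝓘(ℝ, EM) 𝓘(ℝ, EP) s.sec (B.proj p) (B.tProj p u) = 0
    rw [hu, map_zero]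
  have h5 := mfderiv_prod_eq_add_apply (v := mfderiv 𝓘(ℝ, EP) (𝓘(ℝ, EP).prod 𝓘(ℝ, EG)) f p u) hact
  have h6 := mfderiv_prodMk hr hk'
  have h7 := (mfderiv_comp_apply p hact (hr.prodMk hk') u).symm.trans
    (congrArg (fun L : EP →L[ℝ] EP => L u)
      ((h2.mfderiv_eq (I := 𝓘(ℝ, EP)) (I' := 𝓘(ℝ, EP))).trans mfderiv_id))
  have h8 : (mfderiv 𝓘(ℝ, EP) (𝓘(ℝ, EP).prod 𝓘(ℝ, EG)) f p u : EP × EG).1 = 0 :=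
    (congrArg (fun L : EP →L[ℝ] EP × EG => (L u).1) h6).trans h4
  -- The partial derivative in the group variable sits at `((f p).1, (f p).2)`, which is `(p, 1)`
  -- only propositionally.
  have h9 : ∀ (p' : P) (a : G) (ξ : EG), p' = p → a = 1 →
      (mfderiv 𝓘(ℝ, EG) 𝓘(ℝ, EP) (fun z : G => op z • p') a ξ : EP) = B.infGen p ξ := by
    rintro p' a ξ rfl rfl
    rfl
  refine ⟨(mfderiv 𝓘(ℝ, EP) (𝓘(ℝ, EP).prod 𝓘(ℝ, EG)) f p u : EP × EG).2, ?_⟩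
  rw [← h9 (f p).1 (f p).2 _ hp hk]
  refine Eq.trans ?_ (h5.symm.trans h7)
  refine Eq.trans ?_ (congrArg₂ (fun a b : EP => a + b) 
    (congrArg (mfderiv 𝓘(ℝ, EP) 𝓘(ℝ, EP) (fun z : P => act (z, (f p).2)) (f p).1) h8).symm rfl)
  refine (Eq.trans ?_ (congrArg (fun a : EP => a + _) (map_zero _).symm))
  exact (zero_add _).symm

end LocalStructure

end EYM.PrincipalBundle

namespace EYM.PrincipalBundle

variable {EG EP EM G P M : Type*}
  [NormedAddCommGroup EG] [NormedSpace ℝ EG] [NormedAddCommGroup EP] [NormedSpace ℝ EP]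
  [NormedAddCommGroup EM] [NormedSpace ℝ EM]
  [TopologicalSpace G] [ChartedSpace EG G] [Group G] [LieGroup 𝓘(ℝ, EG) ∞ G]
  [TopologicalSpace P] [ChartedSpace EP P] [IsManifold 𝓘(ℝ, EP) ∞ P]
  [TopologicalSpace M] [ChartedSpace EM M] [IsManifold 𝓘(ℝ, EM) ∞ M]
  [MulAction Gᵐᵒᵖ P] {B : PrincipalBundle EG EP EM G P M}

/-! ### The splitting of TP by a connection and its horizontal lifts -/

section HorizontalLift

/-- The kernel of Tπ consists of generators, on which `A` returns the generating element; this gives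
injectivity. For surjectivity, lift `v` arbitrarily and adjust the value of `A` by a generator. -/
theorem Connection.bijective_tProj_prod (A : B.Connection) (p : P) :
    Function.Bijective ((B.tProj p).prod (A.toFun p)) := by
  constructor
  · rw [injective_iff_map_eq_zero]
    intro u hu
    obtain ⟨hu1, hu2⟩ := Prod.ext_iff.1 hu
    obtain ⟨ξ, rfl⟩ := B.exists_infGen_eq hu1
    have h : ξ = 0 := (A.reproduces p ξ).symm.trans hu2
    rw [h, map_zero]
  · rintro ⟨v, ξ⟩
    obtain ⟨u, rfl⟩ := B.tProj_surjective p v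
    refine ⟨u + B.infGen p (ξ - A.toFun p u), Prod.ext ?_ ?_⟩
    · change B.tProj p (u + B.infGen p (ξ - A.toFun p u)) = B.tProj p u
      rw [map_add, B.tProj_infGen, add_zero]
    · change A.toFun p (u + B.infGen p (ξ - A.toFun p u)) = ξ
      rw [map_add, A.reproduces, add_sub_cancel]

theorem Connection.ext_tangent (A : B.Connection) {p : P} {u u' : TangentSpace 𝓘(ℝ, EP) p}
    (h : B.tProj p u = B.tProj p u') (h' : A.toFun p u = A.toFun p u') : u = u' :=
  (A.bijective_tProj_prod p).1 (Prod.ext h h')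

variable [FiniteDimensional ℝ EP]

/-- `ContinuousLinearMap.inverse` takes the default value zero on maps that are not invertible, so
the properties of `Connection.hor` rest on this. Finite dimension makes the algebraic inverse
continuous. -/
theorem Connection.isInvertible_tProj_prod (A : B.Connection) (p : P) :
    ((B.tProj p).prod (A.toFun p)).IsInvertible := by
  let L : EP →L[ℝ] EM × EG := (B.tProj p).prod (A.toFun p)
  exact ⟨(LinearEquiv.ofBijective L.toLinearMap (A.bijective_tProj_prod p)).toContinuousLinearEquiv,
    rfl⟩

theorem Connection.tProj_prod_hor (A : B.Connection) (p : P)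
    (v : TangentSpace 𝓘(ℝ, EM) (B.proj p)) :
    (B.tProj p).prod (A.toFun p) (A.hor p v) = (v, 0) := by
  obtain ⟨e, he⟩ := A.isInvertible_tProj_prod p
  unfold Connection.hor
  rw [← he]
  simp

theorem Connection.tProj_hor (A : B.Connection) (p : P) (v : TangentSpace 𝓘(ℝ, EM) (B.proj p)) :
    B.tProj p (A.hor p v) = v :=
  congrArg Prod.fst (A.tProj_prod_hor p v)

theorem Connection.apply_hor (A : B.Connection) (p : P) (v : TangentSpace 𝓘(ℝ, EM) (B.proj p)) :
    A.toFun p (A.hor p v) = 0 :=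
  congrArg Prod.snd (A.tProj_prod_hor p v)

theorem Connection.hor_add_infGen (A : B.Connection) (p : P) (u : TangentSpace 𝓘(ℝ, EP) p) :
    A.hor p (B.tProj p u) + B.infGen p (A.toFun p u) = u := by
  apply A.ext_tangent
  · rw [map_add, A.tProj_hor, B.tProj_infGen, add_zero]
  · rw [map_add, A.apply_hor, A.reproduces, zero_add]

/-- This replaces the inverse in the definition of `hor` by an explicit correction of an arbitrary
lift, a form in which smoothness can be checked. -/
theorem Connection.hor_eq_sub (A : B.Connection) {p : P} {v : TangentSpace 𝓘(ℝ, EM) (B.proj p)}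
    {u : TangentSpace 𝓘(ℝ, EP) p} (h : B.tProj p u = v) :
    A.hor p v = u - B.infGen p (A.toFun p u) := by
  rw [eq_sub_iff_add_eq, ← h, A.hor_add_infGen]

/-- A horizontal lift is characterized by its projection and the vanishing of `A`, and TΦ_g
preserves both properties. -/
theorem Connection.tAct_hor (A : B.Connection) (g : G) (p : P) (v : EM) :
    (B.tAct g p (A.hor p v) : EP) = A.hor (op g • p) v := by
  apply A.ext_tangent (p := op g • p)
  · exact ((B.tProj_tAct g p (A.hor p v)).trans (A.tProj_hor p v)).trans
      (A.tProj_hor (op g • p) v).symm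
  · refine (A.equivariant g p _).trans (Eq.trans ?_ (A.apply_hor (op g • p) v).symm)
    exact (congrArg (Ad g⁻¹) (A.apply_hor p v)).trans (map_zero _)

/-- Since η covers the identity, Tη keeps the projection, and η^*A vanishes on a vector exactly when
`A` vanishes on its image. -/
theorem Connection.mfderiv_hor_pullback (A : B.Connection) (η : B.Gauge) (p : P) (v : EM) :
    (mfderiv 𝓘(ℝ, EP) 𝓘(ℝ, EP) η.toDiffeo p ((A.pullback η).hor p v) : EP) =
      A.hor (η.toDiffeo p) v := by
  have h1 := mfderiv_comp_apply p
    (B.smooth_proj.mdifferentiable (by simp) (η.toDiffeo p))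
    (η.toDiffeo.contMDiff.mdifferentiable (by simp) p) ((A.pullback η).hor p v)
  have h2 : B.proj ∘ η.toDiffeo = B.proj := funext fun q => η.over_id q
  rw [h2] at h1
  apply A.ext_tangent (p := η.toDiffeo p)
  · exact (h1.symm.trans ((A.pullback η).tProj_hor p v)).trans (A.tProj_hor (η.toDiffeo p) v).symm
  · exact ((A.pullback η).apply_hor p v).trans (A.apply_hor (η.toDiffeo p) v).symm

end HorizontalLift

/-! ### Smooth dependence of generators and local lifts -/

section SmoothFamilies

variable {EW HW W : Type*} [NormedAddCommGroup EW] [NormedSpace ℝ EW]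
  [TopologicalSpace HW] {J : ModelWithCorners ℝ EW HW} [TopologicalSpace W] [ChartedSpace HW W]
  [IsManifold J ∞ W]

theorem contMDiffAt_infGen (B : PrincipalBundle EG EP EM G P M) {b : W → P} {ξ : W → EG} {w₀ : W}
    (hb : ContMDiffAt J 𝓘(ℝ, EP) ∞ b w₀) (hξ : ContMDiffAt J 𝓘(ℝ, EG) ∞ ξ w₀) :
    ContMDiffAt J 𝓘(ℝ, EP).tangent ∞
      (fun w => (⟨b w, B.infGen (b w) (ξ w)⟩ : TangentBundle 𝓘(ℝ, EP) P)) w₀ := by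
  have h := contMDiffAt_mfderiv_family (φ := fun (w : W) (h : G) => op h • b w) (b := fun _ => 1)
    (v := ξ) (w₀ := w₀) (J := J) (N' := P) (E' := EP) (E := EG)
    (B.smooth_act.contMDiffAt.comp (w₀, (1 : G))
      ((hb.comp (w₀, (1 : G)) contMDiffAt_fst).prodMk contMDiffAt_snd))
    (contMDiffAt_tangentVector_const hξ)
  exact h.congr_of_eventuallyEq (Filter.Eventually.of_forall fun w =>
    tangentBundle_mk_eq (by simp) rfl)

/-- The lift of tangent vectors of the base along the translates of a local section. -/
noncomputable def LocalSection.lift (s : B.LocalSection) (q : P) (v : TangentSpace 𝓘(ℝ, EM) (B.proj q)) :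
    TangentSpace 𝓘(ℝ, EP) q :=
  (mfderiv 𝓘(ℝ, EM) 𝓘(ℝ, EP) (fun x => op (s.coord q) • s.sec x) (B.proj q) v : EP)

theorem LocalSection.tProj_lift (s : B.LocalSection) {q : P} (hq : B.proj q ∈ s.base)
    (v : TangentSpace 𝓘(ℝ, EM) (B.proj q)) : B.tProj q (s.lift q v) = v := by
  have h0 : ContMDiffAt 𝓘(ℝ, EM) 𝓘(ℝ, EP) ∞ (fun x => op (s.coord q) • s.sec x) (B.proj q) :=
    (B.smooth_act_right (s.coord q)).contMDiffAt.comp _ (s.contMDiffAt_sec hq)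
  have h1 := mfderiv_comp_apply (B.proj q)
    (B.smooth_proj.mdifferentiable (by simp) (op (s.coord q) • s.sec (B.proj q)))
    (h0.mdifferentiableAt (by simp)) v
  have h2 : B.proj ∘ (fun x => op (s.coord q) • s.sec x) =ᶠ[nhds (B.proj q)] id := by
    filter_upwards [s.isOpen_base.mem_nhds hq] with x hx
    exact (B.proj_act _ _).trans (s.proj_sec x hx)
  rw [h2.mfderiv_eq, mfderiv_id] at h1
  exact (B.tProj_congr (s.coord_smul_sec q hq).symm rfl).trans h1.symm

theorem LocalSection.contMDiffAt_lift (s : B.LocalSection) {b : W → P}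
    {v : ∀ w, TangentSpace 𝓘(ℝ, EM) (B.proj (b w))} {w₀ : W} (hs : B.proj (b w₀) ∈ s.base)
    (hb : ContMDiffAt J 𝓘(ℝ, EP) ∞ b w₀)
    (hv : ContMDiffAt J 𝓘(ℝ, EM).tangent ∞
      (fun w => (⟨B.proj (b w), v w⟩ : TangentBundle 𝓘(ℝ, EM) M)) w₀) :
    ContMDiffAt J 𝓘(ℝ, EP).tangent ∞
      (fun w => (⟨b w, s.lift (b w) (v w)⟩ : TangentBundle 𝓘(ℝ, EP) P)) w₀ := by
  have h := contMDiffAt_mfderiv_family (φ := fun (w : W) (x : M) => op (s.coord (b w)) • s.sec x)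
    (b := fun w => B.proj (b w)) (v := v) (w₀ := w₀) (J := J) (N' := P) (E' := EP) (E := EM)
    (B.smooth_act.contMDiffAt.comp (w₀, B.proj (b w₀))
      (((s.contMDiffAt_sec hs).comp (w₀, B.proj (b w₀)) contMDiffAt_snd).prodMk
        (((s.contMDiffAt_coord hs).comp w₀ hb).comp (w₀, B.proj (b w₀)) contMDiffAt_fst))) hv
  refine h.congr_of_eventuallyEq ?_
  filter_upwards [hb.continuousAt.preimage_mem_nhds (s.preimage_base_mem_nhds hs)] with w hw
  exact tangentBundle_mk_eq (s.coord_smul_sec (b w) hw).symm rfl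

end SmoothFamilies

end EYM.PrincipalBundle

namespace EYM

/-! ### Families of one-forms and of horizontal lifts -/

section FormFamilies

variable {EW HW W E N V T : Type*} [NormedAddCommGroup EW] [NormedSpace ℝ EW]
  [TopologicalSpace HW] {J : ModelWithCorners ℝ EW HW} [TopologicalSpace W] [ChartedSpace HW W]
  [NormedAddCommGroup E] [NormedSpace ℝ E] [TopologicalSpace N] [ChartedSpace E N]
  [IsManifold 𝓘(ℝ, E) ∞ N] [NormedAddCommGroup V] [NormedSpace ℝ V]
  [NormedAddCommGroup T] [NormedSpace ℝ T]

/-- A family of one-forms that is jointly smooth in the parameter and the tangent vector. -/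
def IsSmoothFormFamily (α : T → OneForm E N V) : Prop :=
  ContMDiff (𝓘(ℝ, T).prod 𝓘(ℝ, E).tangent) 𝓘(ℝ, V) ∞
    (fun y : T × TangentBundle 𝓘(ℝ, E) N => α y.1 y.2.1 y.2.2)

theorem IsSmoothFormFamily.contMDiffAt_apply {α : T → OneForm E N V} (hα : IsSmoothFormFamily α)
    {τ : W → T} {b : W → N} {v : ∀ w, TangentSpace 𝓘(ℝ, E) (b w)} {w₀ : W}
    (hτ : ContMDiffAt J 𝓘(ℝ, T) ∞ τ w₀)
    (hv : ContMDiffAt J 𝓘(ℝ, E).tangent ∞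
      (fun w => (⟨b w, v w⟩ : TangentBundle 𝓘(ℝ, E) N)) w₀) :
    ContMDiffAt J 𝓘(ℝ, V) ∞ (fun w => α (τ w) (b w) (v w)) w₀ :=
  (hα.contMDiffAt (x := (τ w₀, (⟨b w₀, v w₀⟩ : TangentBundle 𝓘(ℝ, E) N)))).comp w₀ (hτ.prodMk hv)

theorem isSmoothFormFamily_const (α : OneForm E N V) : IsSmoothFormFamily (fun _ : T => α) :=
  α.smooth.comp contMDiff_snd

end FormFamilies

namespace PrincipalBundle

variable {EG EP EM G P M T EW HW W : Type*}
  [NormedAddCommGroup EG] [NormedSpace ℝ EG] [NormedAddCommGroup EP] [NormedSpace ℝ EP]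
  [NormedAddCommGroup EM] [NormedSpace ℝ EM] [FiniteDimensional ℝ EP]
  [TopologicalSpace G] [ChartedSpace EG G] [Group G] [LieGroup 𝓘(ℝ, EG) ∞ G]
  [TopologicalSpace P] [ChartedSpace EP P] [IsManifold 𝓘(ℝ, EP) ∞ P]
  [TopologicalSpace M] [ChartedSpace EM M] [IsManifold 𝓘(ℝ, EM) ∞ M]
  [MulAction Gᵐᵒᵖ P] {B : PrincipalBundle EG EP EM G P M}
  [NormedAddCommGroup T] [NormedSpace ℝ T]
  [NormedAddCommGroup EW] [NormedSpace ℝ EW]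
  [TopologicalSpace HW] {J : ModelWithCorners ℝ EW HW} [TopologicalSpace W] [ChartedSpace HW W]
  [IsManifold J ∞ W]

/-- Horizontal lifts depend smoothly on the connection, the point and the tangent vector. -/
theorem contMDiffAt_hor {A : T → B.Connection}
    (hA : IsSmoothFormFamily (fun t => (A t).toOneForm)) {τ : W → T} {b : W → P}
    {v : ∀ w, TangentSpace 𝓘(ℝ, EM) (B.proj (b w))} {w₀ : W}
    (hτ : ContMDiffAt J 𝓘(ℝ, T) ∞ τ w₀) (hb : ContMDiffAt J 𝓘(ℝ, EP) ∞ b w₀)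
    (hv : ContMDiffAt J 𝓘(ℝ, EM).tangent ∞
      (fun w => (⟨B.proj (b w), v w⟩ : TangentBundle 𝓘(ℝ, EM) M)) w₀) :
    ContMDiffAt J 𝓘(ℝ, EP).tangent ∞
      (fun w => (⟨b w, (A (τ w)).hor (b w) (v w)⟩ : TangentBundle 𝓘(ℝ, EP) P)) w₀ := by
  -- The lift along a local section is smooth and does not involve the connection; subtracting the
  -- generator of its `A`-value makes it horizontal.
  obtain ⟨s, hs, -, -⟩ := B.exists_localSection (b w₀)
  have h1 := s.contMDiffAt_lift hs hb hv
  have h2 := hA.contMDiffAt_apply hτ h1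
  have h3 := contMDiffAt_tangentVector_add h1 (B.contMDiffAt_infGen hb h2.neg)
  refine h3.congr_of_eventuallyEq ?_
  filter_upwards [hb.continuousAt.preimage_mem_nhds (s.preimage_base_mem_nhds hs)] with w hw
  refine tangentBundle_mk_eq rfl ?_
  refine ((A (τ w)).hor_eq_sub (s.tProj_lift hw (v w))).trans ?_
  rw [map_neg, sub_eq_add_neg]

end PrincipalBundle

end EYM

namespace EYM

/-! ### Plots as jointly smooth families -/

section Plots

variable {E N V X Y : Type*} [NormedAddCommGroup E] [NormedSpace ℝ E] [TopologicalSpace N]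
  [ChartedSpace E N] [IsManifold 𝓘(ℝ, E) ∞ N] [NormedAddCommGroup V] [NormedSpace ℝ V]

theorem OneForm.ext {α β : OneForm E N V} (h : ∀ x (v : TangentSpace 𝓘(ℝ, E) x), α.toFun x v = β.toFun x v) :
    α = β := by
  obtain ⟨a, ha⟩ := α
  obtain ⟨b, hb⟩ := β
  have : a = b := funext fun x => ContinuousLinearMap.ext (h x)
  subst this
  rfl

theorem isPlot_oneForm_iff {n : ℕ} {α : EuclideanSpace ℝ (Fin n) → OneForm E N V} :
    IsPlot α ↔ IsSmoothFormFamily α := Iff.rfl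

theorem isPlot_prod_iff [DiffeologicalSpace X] [DiffeologicalSpace Y] {n : ℕ}
    {p : EuclideanSpace ℝ (Fin n) → X × Y} :
    IsPlot p ↔ IsPlot (fun t => (p t).1) ∧ IsPlot (fun t => (p t).2) := Iff.rfl

theorem isPlot_subtype_iff [DiffeologicalSpace X] {S : Set X} {n : ℕ}
    {p : EuclideanSpace ℝ (Fin n) → S} : IsPlot p ↔ IsPlot (fun t => (p t : X)) := Iff.rfl

end Plots

/-! ### The adjoint action, and decomposing and assembling invariant forms -/

section Adjoint

variable {EG G : Type*} [NormedAddCommGroup EG] [NormedSpace ℝ EG] [TopologicalSpace G]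
  [ChartedSpace EG G] [Group G]

theorem contMDiff_conj [LieGroup 𝓘(ℝ, EG) ∞ G] (g : G) : ContMDiff 𝓘(ℝ, EG) 𝓘(ℝ, EG) ∞ (fun h : G => g * h * g⁻¹) :=
  (contMDiff_const.mul contMDiff_id).mul contMDiff_const

theorem Ad_eq_mfderiv_of_eq_one (g : G) {a : G} (ha : a = 1) (ξ : EG) :
    (mfderiv 𝓘(ℝ, EG) 𝓘(ℝ, EG) (fun h : G => g * h * g⁻¹) a ξ : EG) = Ad g ξ := by
  subst ha
  rfl

theorem Ad_Ad_inv [LieGroup 𝓘(ℝ, EG) ∞ G] (g : G) (ξ : EG) : Ad g (Ad g⁻¹ ξ) = ξ := by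
  have h1 := mfderiv_comp_apply (1 : G)
    ((contMDiff_conj (EG := EG) g).mdifferentiable (by simp) (g⁻¹ * 1 * g⁻¹⁻¹))
    ((contMDiff_conj (EG := EG) g⁻¹).mdifferentiable (by simp) 1) ξ
  have h2 : (fun h : G => g * h * g⁻¹) ∘ (fun h : G => g⁻¹ * h * g⁻¹⁻¹) = id := funext fun h => by
    simp [mul_assoc]
  rw [h2, mfderiv_id] at h1
  exact (Ad_eq_mfderiv_of_eq_one g (by simp) _).symm.trans h1.symm

end Adjoint

namespace PrincipalBundle

variable {EG EP EM G P M T EW HW W : Type*}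
  [NormedAddCommGroup EG] [NormedSpace ℝ EG] [NormedAddCommGroup EP] [NormedSpace ℝ EP]
  [NormedAddCommGroup EM] [NormedSpace ℝ EM]
  [TopologicalSpace G] [ChartedSpace EG G] [Group G] [LieGroup 𝓘(ℝ, EG) ∞ G]
  [TopologicalSpace P] [ChartedSpace EP P] [IsManifold 𝓘(ℝ, EP) ∞ P]
  [TopologicalSpace M] [ChartedSpace EM M] [IsManifold 𝓘(ℝ, EM) ∞ M]
  [MulAction Gᵐᵒᵖ P] {B : PrincipalBundle EG EP EM G P M}
  [NormedAddCommGroup T] [NormedSpace ℝ T]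

theorem HorizontalForm.ext {Y Y' : B.HorizontalForm} (h : Y.toOneForm = Y'.toOneForm) :
    Y = Y' := by
  cases Y
  cases Y'
  cases h
  rfl

theorem InvariantForm.ext {m m' : B.InvariantForm} (h : m.toOneForm = m'.toOneForm) : m = m' := by
  cases m
  cases m'
  cases h
  rfl

theorem EquivariantMap.ext {V : Type*} [NormedAddCommGroup V] [NormedSpace ℝ V]
    {r : G → V →L[ℝ] V} {f f' : B.EquivariantMap V r} (h : ∀ p, f.toFun p = f'.toFun p) :
    f = f' := by
  obtain ⟨a, _, _⟩ := f
  obtain ⟨b, _, _⟩ := f'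
  have : a = b := funext h
  subst this
  rfl

/-- A family of equivariant maps that is jointly smooth in the parameter and the point. -/
def IsSmoothMapFamily {V : Type*} [NormedAddCommGroup V] [NormedSpace ℝ V] {r : G → V →L[ℝ] V}
    (f : T → B.EquivariantMap V r) : Prop :=
  ContMDiff (𝓘(ℝ, T).prod 𝓘(ℝ, EP)) 𝓘(ℝ, V) ∞ (fun y : T × P => (f y.1).toFun y.2)

theorem isPlot_equivariantMap_iff {V : Type*} [NormedAddCommGroup V] [NormedSpace ℝ V]
    {r : G → V →L[ℝ] V} {n : ℕ} {f : EuclideanSpace ℝ (Fin n) → B.EquivariantMap V r} :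
    IsPlot f ↔ IsSmoothMapFamily f := Iff.rfl

theorem isPlot_connection_iff {n : ℕ} {A : EuclideanSpace ℝ (Fin n) → B.Connection} :
    IsPlot A ↔ IsSmoothFormFamily (fun t => (A t).toOneForm) := Iff.rfl

theorem isPlot_horizontalForm_iff {n : ℕ} {Y : EuclideanSpace ℝ (Fin n) → B.HorizontalForm} :
    IsPlot Y ↔ IsSmoothFormFamily (fun t => (Y t).toOneForm) := Iff.rfl

theorem isPlot_invariantForm_iff {n : ℕ} {m : EuclideanSpace ℝ (Fin n) → B.InvariantForm} :
    IsPlot m ↔ IsSmoothFormFamily (fun t => (m t).toOneForm) := Iff.rfl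

/-- Differentiate p·g·h = (p · ghg⁻¹)·g at h = 1. -/
theorem infGen_smul (B : PrincipalBundle EG EP EM G P M) (g : G) (p : P) (ξ : EG) :
    (B.infGen (op g • p) ξ : EP) = B.tAct g p (B.infGen p (Ad g ξ)) := by
  have h1 := mfderiv_comp_apply (1 : G)
    ((B.contMDiff_orbit p).mdifferentiable (by simp) (g * 1 * g⁻¹))
    ((contMDiff_conj (EG := EG) g).mdifferentiable (by simp) 1) ξ
  have h2 := mfderiv_comp_apply (1 : G)
    ((B.smooth_act_right g).mdifferentiable (by simp) (op (g * 1 * g⁻¹) • p))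
    (((B.contMDiff_orbit p).comp (contMDiff_conj g)).mdifferentiable (by simp) 1) ξ
  have h3 : (fun q : P => op g • q) ∘ ((fun h : G => op h • p) ∘ (fun h : G => g * h * g⁻¹)) =
      fun h : G => op h • op g • p := funext fun h => by
    simp [smul_smul, ← op_mul]
  rw [h3] at h2
  refine h2.trans ?_
  refine B.tAct_congr g (by simp) (h1.trans ?_)
  have key : ∀ (a : G) (ζ ζ' : EG), a = 1 → ζ = ζ' →
      (mfderiv 𝓘(ℝ, EG) 𝓘(ℝ, EP) (fun h : G => op h • p) a ζ : EP) = B.infGen p ζ' := by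
    rintro _ _ _ rfl rfl
    rfl
  exact key _ _ _ (by simp) rfl

/-- The map `𝕁 ∘ m`. -/
noncomputable def InvariantForm.momentum [FiniteDimensional ℝ EG] (m : B.InvariantForm) :
    B.CoadMap where
  toFun p := (m.toFun p).comp (B.infGen p)
  smooth p := contMDiffAt_dual_of_apply fun _ =>
    (isSmoothFormFamily_const (T := ℝ) m.toOneForm).contMDiffAt_apply
      (contMDiffAt_const (c := (0 : ℝ))) (B.contMDiffAt_infGen contMDiffAt_id contMDiffAt_const)
  equivariant p g := by
    ext ξ
    exact (m.toOneForm.congr_point rfl (B.infGen_smul g p ξ)).trans (m.invariant g p _)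

theorem InvariantForm.isSmoothMapFamily_momentum [FiniteDimensional ℝ EG]
    {m : T → B.InvariantForm} (hm : IsSmoothFormFamily (fun t => (m t).toOneForm)) :
    IsSmoothMapFamily (fun t => (m t).momentum) := fun _ =>
  contMDiffAt_dual_of_apply fun _ => hm.contMDiffAt_apply contMDiffAt_fst
    (B.contMDiffAt_infGen contMDiffAt_snd contMDiffAt_const)

/-- The invariant form with horizontal part `n` and vertical part `ν` for the connection `A`. -/
noncomputable def InvariantForm.ofParts (n : OneForm EM M ℝ) (ν : B.CoadMap) (A : B.Connection) :
    B.InvariantForm where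
  toFun p := (n.toFun (B.proj p)).comp (B.tProj p) + (ν.toFun p).comp (A.toFun p)
  smooth := by
    refine ContMDiff.add ?_ ?_
    · exact n.smooth.comp (B.smooth_proj.contMDiff_tangentMap (m := ∞) (n := ∞) le_rfl)
    · exact (ν.smooth.comp (Bundle.contMDiff_proj _)).clm_apply A.smooth
  invariant g p u := by
    have h1 : n.toFun (B.proj (op g • p)) (B.tProj (op g • p) (B.tAct g p u)) =
        n.toFun (B.proj p) (B.tProj p u) := n.congr_point (B.proj_act p g) (B.tProj_tAct g p u)
    have h2 : ν.toFun (op g • p) (A.toFun (op g • p) (B.tAct g p u)) =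
        ν.toFun p (A.toFun p u) := by
      rw [ν.equivariant, A.equivariant]
      exact congrArg (ν.toFun p) (Ad_Ad_inv g _)
    exact congrArg₂ (· + ·) h1 h2

theorem InvariantForm.isSmoothFormFamily_ofParts {n : T → OneForm EM M ℝ} {ν : T → B.CoadMap}
    {A : T → B.Connection} (hn : IsSmoothFormFamily n) (hν : IsSmoothMapFamily ν)
    (hA : IsSmoothFormFamily (fun t => (A t).toOneForm)) :
    IsSmoothFormFamily (fun t => (InvariantForm.ofParts (n t) (ν t) (A t)).toOneForm) := by
  refine ContMDiff.add ?_ ?_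
  · exact hn.comp (contMDiff_fst.prodMk
      ((B.smooth_proj.contMDiff_tangentMap (m := ∞) (n := ∞) le_rfl).comp contMDiff_snd))
  · exact (hν.comp (contMDiff_fst.prodMk ((Bundle.contMDiff_proj _).comp contMDiff_snd))).clm_apply hA

/-- On a generator the pulled-back form vanishes and `A` returns the generating element. -/
theorem InvariantForm.momentum_ofParts [FiniteDimensional ℝ EG] (n : OneForm EM M ℝ)
    (ν : B.CoadMap) (A : B.Connection) : (InvariantForm.ofParts n ν A).momentum = ν := by
  refine EquivariantMap.ext fun p => ContinuousLinearMap.ext fun ξ => ?_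
  change n.toFun (B.proj p) (B.tProj p (B.infGen p ξ)) + ν.toFun p (A.toFun p (B.infGen p ξ)) = _
  rw [B.tProj_infGen, A.reproduces]
  exact (congrArg (· + _) (map_zero _)).trans (zero_add _)

theorem HorizontalForm.neg_neg (Y : B.HorizontalForm) : Y.neg.neg = Y :=
  HorizontalForm.ext (OneForm.ext fun _ _ => _root_.neg_neg (G := EG) _)

theorem HorizontalForm.dSmooth_neg : DSmooth (HorizontalForm.neg (B := B)) := fun _ _ hY =>
  ContMDiff.neg (isPlot_horizontalForm_iff.1 hY)

/-! ### The descended horizontal part and the diffeomorphism `i` -/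

section HorizontalPart

variable [FiniteDimensional ℝ EP]

/-- Two points of a fibre differ by some g, and TΦ_g preserves both `m` and the horizontal lifts.
Hence the horizontal part of `m` is well defined on M. -/
theorem InvariantForm.apply_hor_eq (m : B.InvariantForm) (A : B.Connection) {p q : P}
    (h : B.proj p = B.proj q) (v : EM) :
    m.toFun p (A.hor p v) = m.toFun q (A.hor q v) := by
  obtain ⟨g, rfl⟩ := B.exists_smul_eq_of_proj_eq h
  exact (m.invariant g p _).symm.trans (m.toOneForm.congr_point rfl (A.tAct_hor g p v))

/-- The set-theoretic section `σ` need not be continuous. Near each point it may be exchanged for a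
smooth local section without changing the value, by `InvariantForm.apply_hor_eq`. -/
theorem contMDiff_apply_hor {m : T → B.InvariantForm} {A : T → B.Connection}
    (hm : IsSmoothFormFamily (fun t => (m t).toOneForm))
    (hA : IsSmoothFormFamily (fun t => (A t).toOneForm)) {σ : M → P} (hσ : ∀ x, B.proj (σ x) = x) :
    ContMDiff (𝓘(ℝ, T).prod 𝓘(ℝ, EM).tangent) 𝓘(ℝ, ℝ) ∞
      (fun y : T × TangentBundle 𝓘(ℝ, EM) M =>
        (m y.1).toFun (σ y.2.1) ((A y.1).hor (σ y.2.1) (y.2.2 : EM))) := by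
  rintro ⟨t, x, v⟩
  obtain ⟨s, hs, -, -⟩ := B.exists_localSection (σ x)
  rw [hσ] at hs
  have hsec : ContMDiffAt (𝓘(ℝ, T).prod 𝓘(ℝ, EM).tangent) 𝓘(ℝ, EP) ∞
      (fun y : T × TangentBundle 𝓘(ℝ, EM) M => s.sec y.2.1) (t, ⟨x, v⟩) :=
    (s.contMDiffAt_sec hs).comp (t, (⟨x, v⟩ : TangentBundle 𝓘(ℝ, EM) M))
      (((Bundle.contMDiff_proj _).comp contMDiff_snd).contMDiffAt)
  have hnear : ∀ᶠ y : T × TangentBundle 𝓘(ℝ, EM) M in nhds (t, ⟨x, v⟩), y.2.1 ∈ s.base :=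
    ((FiberBundle.continuous_proj EM (TangentSpace 𝓘(ℝ, EM) : M → Type _)).comp
      continuous_snd).continuousAt.preimage_mem_nhds (s.isOpen_base.mem_nhds hs)
  have h1 := contMDiffAt_hor hA (J := 𝓘(ℝ, T).prod 𝓘(ℝ, EM).tangent)
    (τ := fun y : T × TangentBundle 𝓘(ℝ, EM) M => y.1) (v := fun y => (y.2.2 : EM))
    (w₀ := (t, ⟨x, v⟩)) contMDiffAt_fst hsec
    (contMDiffAt_snd.congr_of_eventuallyEq (by
      filter_upwards [hnear] with y hy
      exact tangentBundle_mk_eq (s.proj_sec _ hy) rfl))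
  refine (hm.contMDiffAt_apply contMDiffAt_fst h1).congr_of_eventuallyEq ?_
  filter_upwards [hnear] with y hy
  exact (m y.1).apply_hor_eq (A y.1) ((hσ _).trans (s.proj_sec _ hy).symm) _

/-- The form `n = (Hor_A)^* ∘ m` on the base. -/
noncomputable def InvariantForm.horPart (m : B.InvariantForm) (A : B.Connection) :
    OneForm EM M ℝ where
  toFun x := ((m.toFun (Function.surjInv B.proj_surjective x)).comp
    (A.hor (Function.surjInv B.proj_surjective x)) : EM →L[ℝ] ℝ)
  smooth := (contMDiff_apply_hor (T := ℝ) (isSmoothFormFamily_const m.toOneForm)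
    (isSmoothFormFamily_const A.toOneForm) (Function.surjInv_eq B.proj_surjective)).comp
      (contMDiff_const (c := (0 : ℝ)).prodMk contMDiff_id)

theorem InvariantForm.isSmoothFormFamily_horPart {m : T → B.InvariantForm} {A : T → B.Connection}
    (hm : IsSmoothFormFamily (fun t => (m t).toOneForm))
    (hA : IsSmoothFormFamily (fun t => (A t).toOneForm)) :
    IsSmoothFormFamily (fun t => (m t).horPart (A t)) :=
  contMDiff_apply_hor hm hA (Function.surjInv_eq B.proj_surjective)

theorem InvariantForm.horPart_apply (m : B.InvariantForm) (A : B.Connection) (p : P)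
    (v : TangentSpace 𝓘(ℝ, EM) (B.proj p)) :
    (m.horPart A).toFun (B.proj p) v = m.toFun p (A.hor p v) :=
  m.apply_hor_eq A (Function.surjInv_eq B.proj_surjective _) v

/-- This is `m` evaluated on u = Hor_A(Tπ u) + (A u)_P. -/
theorem InvariantForm.ofParts_horPart_momentum [FiniteDimensional ℝ EG] (m : B.InvariantForm)
    (A : B.Connection) : InvariantForm.ofParts (m.horPart A) m.momentum A = m := by
  refine InvariantForm.ext (OneForm.ext fun p u => ?_)
  change (m.horPart A).toFun (B.proj p) (B.tProj p u) + m.toFun p (B.infGen p (A.toFun p u)) = _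
  rw [m.horPart_apply]
  exact (map_add (m.toFun p) _ _).symm.trans (congrArg (m.toFun p) (A.hor_add_infGen p u))

theorem InvariantForm.horPart_ofParts (n : OneForm EM M ℝ) (ν : B.CoadMap) (A : B.Connection) :
    (InvariantForm.ofParts n ν A).horPart A = n := by
  refine OneForm.ext fun x v => ?_
  obtain ⟨p, rfl⟩ := B.proj_surjective x
  rw [InvariantForm.horPart_apply]
  change n.toFun (B.proj p) (B.tProj p (A.hor p v)) + ν.toFun p (A.toFun p (A.hor p v)) = _
  refine (congrArg₂ (fun a b => n.toFun (B.proj p) a + ν.toFun p b) (A.tProj_hor p v)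
    (A.apply_hor p v)).trans ?_
  exact (congrArg _ (map_zero _)).trans (add_zero _)

variable (B)

/-- The decomposition `(m, ρ, s, A, Y) ↦ (Hor_A^* ∘ m, ρ, s, 𝕁 ∘ m, A, -Y)`. -/
noncomputable def splitting [FiniteDimensional ℝ EG] :
    (B.SDual × B.CotangentConn) ≃ (B.KDual × B.CoadMap × B.CotangentConn) where
  toFun z := ((z.1.1.horPart z.2.1, z.1.2), z.1.1.momentum, (z.2.1, z.2.2.neg))
  invFun w := ((InvariantForm.ofParts w.1.1 w.2.1 w.2.2.1, w.1.2), (w.2.2.1, w.2.2.2.neg))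
  left_inv z := by
    obtain ⟨⟨m, ρs⟩, A, Y⟩ := z
    simp only [InvariantForm.ofParts_horPart_momentum, HorizontalForm.neg_neg]
  right_inv w := by
    obtain ⟨⟨n, ρs⟩, ν, A, Y⟩ := w
    simp only [InvariantForm.horPart_ofParts, InvariantForm.momentum_ofParts,
      HorizontalForm.neg_neg]

theorem isDiffeo_splitting [FiniteDimensional ℝ EG] : IsDiffeo B.splitting := by
  constructor
  · rintro n p ⟨⟨h1, h2⟩, h3, h4⟩
    have h1' := isPlot_invariantForm_iff.1 h1
    refine isPlot_prod_iff.2 ⟨isPlot_prod_iff.2 ⟨?_, h2⟩,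
      isPlot_prod_iff.2 ⟨?_, isPlot_prod_iff.2 ⟨h3, ?_⟩⟩⟩
    · exact isPlot_oneForm_iff.2
        (InvariantForm.isSmoothFormFamily_horPart h1' (isPlot_connection_iff.1 h3))
    · exact isPlot_equivariantMap_iff.2 (InvariantForm.isSmoothMapFamily_momentum h1')
    · exact HorizontalForm.dSmooth_neg n _ h4
  · rintro n p ⟨⟨h1, h2⟩, h3, h4, h5⟩
    refine isPlot_prod_iff.2 ⟨isPlot_prod_iff.2 ⟨?_, h2⟩, isPlot_prod_iff.2 ⟨h4, ?_⟩⟩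
    · exact isPlot_invariantForm_iff.2 (InvariantForm.isSmoothFormFamily_ofParts
        (isPlot_oneForm_iff.1 h1) (isPlot_equivariantMap_iff.1 h3) (isPlot_connection_iff.1 h4))
    · exact HorizontalForm.dSmooth_neg n _ h5

theorem splitting_gaugeAct [FiniteDimensional ℝ EG] (η : B.Gauge)
    (z : B.SDual × B.CotangentConn) :
    B.splitting (gaugeAct η z) = gaugeAct' η (B.splitting z) := by
  obtain ⟨⟨m, ρs⟩, A, Y⟩ := z
  have h1 : (m.coad η).horPart (A.pullback η) = m.horPart A := by
    refine OneForm.ext fun x v => ?_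
    obtain ⟨p, rfl⟩ := B.proj_surjective x
    rw [InvariantForm.horPart_apply]
    -- Tη turns the η^*A-horizontal lift at `p` into the A-horizontal lift at η(p), which lies in
    -- the same fibre and so computes the same form on M.
    refine (m.toOneForm.congr_point rfl (A.mfderiv_hor_pullback η p v)).trans ?_
    exact (m.horPart_apply A (η.toDiffeo p) v).symm.trans
      ((m.horPart A).congr_point (η.over_id p) rfl)
  have h2 : (m.coad η).momentum = CoadMap.comp m.momentum η :=
    EquivariantMap.ext fun p => ContinuousLinearMap.ext fun ξ =>
      m.toOneForm.congr_point rfl (η.mfderiv_infGen p ξ)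
  have h3 : (Y.pullback η).neg = Y.neg.pullback η :=
    HorizontalForm.ext (OneForm.ext fun _ _ => rfl)
  change (((m.coad η).horPart (A.pullback η), ρs), (m.coad η).momentum,
    (A.pullback η, (Y.pullback η).neg)) = _
  rw [h1, h2, h3]
  rfl

end HorizontalPart

end PrincipalBundle

end EYM

namespace EYM

/-! ### Piola's identity and the divergence of vector densities -/

section Piola

variable {X V n : Type*} [NormedAddCommGroup X] [NormedSpace ℝ X] [NormedAddCommGroup V]
  [NormedSpace ℝ V] [Fintype n] [DecidableEq n]

/-- Jacobi's formula for the derivative of a determinant. -/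
theorem hasFDerivAt_det {a : X → Matrix n n ℝ} {a' : n → n → X →L[ℝ] ℝ} {z : X}
    (ha : ∀ i k, HasFDerivAt (fun y => a y i k) (a' i k) z) :
    HasFDerivAt (fun y => (a y).det) (∑ i, ∑ k, (a z).adjugate k i • a' i k) z := by
  let D : ContinuousMultilinearMap ℝ (fun _ : n => n → ℝ) ℝ :=
    { Matrix.detRowAlternating.toMultilinearMap with
      cont := by
        change Continuous fun A : Matrix n n ℝ => A.det
        fun_prop }
  have h1 := HasFDerivAt.multilinear_comp D (g := fun i y => a y i)
    (g' := fun i => ContinuousLinearMap.pi (a' i)) (x := z)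
    (fun i => hasFDerivAt_pi.2 (ha i))
  refine h1.congr_fderiv ?_
  refine Finset.sum_congr rfl fun i _ => ContinuousLinearMap.ext fun v => ?_
  change ((a z).updateRow i (fun k => a' i k v)).det = _
  -- Replacing one row in a determinant is Cramer's rule, which produces the cofactors.
  rw [← Matrix.cramer_transpose_apply, Matrix.cramer_eq_adjugate_mulVec]
  simp [Matrix.mulVec, dotProduct, ← Matrix.adjugate_transpose]

theorem differentiableAt_det {a : X → Matrix n n ℝ} {z : X}
    (ha : ∀ i k, DifferentiableAt ℝ (fun y => a y i k) z) :
    DifferentiableAt ℝ (fun y => (a y).det) z :=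
  (hasFDerivAt_det fun i k => (ha i k).hasFDerivAt).differentiableAt

theorem differentiableAt_adjugate {a : X → Matrix n n ℝ} {z : X}
    (ha : ∀ i k, DifferentiableAt ℝ (fun y => a y i k) z) (k j : n) :
    DifferentiableAt ℝ (fun y => (a y).adjugate k j) z := by
  simp only [Matrix.adjugate_apply]
  refine differentiableAt_det fun i l => ?_
  by_cases h : i = j
  · simp [h]
  · simpa [Matrix.updateRow_ne h] using ha i l

/-- Piola's identity: if `a` is the Jacobian matrix of a change of coordinates, then the rows of
its adjugate are divergence-free. -/
theorem sum_fderiv_adjugate_eq_zero {a : X → Matrix n n ℝ} {z : X} {v : n → X}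
    (ha : ∀ i k, DifferentiableAt ℝ (fun y => a y i k) z) (hdet : (a z).det ≠ 0)
    (hsymm : ∀ i j k, fderiv ℝ (fun y => a y i k) z (v j) = fderiv ℝ (fun y => a y j k) z (v i))
    (k : n) : ∑ j, fderiv ℝ (fun y => (a y).adjugate k j) z (v j) = 0 := by
  have hc := differentiableAt_adjugate ha
  have h1 : ∀ i j, fderiv ℝ (fun y => ∑ k, a y i k * (a y).adjugate k j) z (v j) =
      ∑ k, (a z i k * fderiv ℝ (fun y => (a y).adjugate k j) z (v j) +
        (a z).adjugate k j * fderiv ℝ (fun y => a y i k) z (v j)) := by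
    intro i j
    have h : HasFDerivAt (fun y => ∑ k, a y i k * (a y).adjugate k j) _ z :=
      HasFDerivAt.fun_sum fun k _ => (ha i k).hasFDerivAt.fun_mul (hc k j).hasFDerivAt
    rw [h.fderiv]
    simp
  have h2 : ∀ i j, (fun y => ∑ k, a y i k * (a y).adjugate k j) =
      fun y => if i = j then (a y).det else 0 := by
    intro i j
    funext y
    have := congrFun₂ (Matrix.mul_adjugate (a y)) i j
    rw [Matrix.mul_apply] at this
    simp [this, Matrix.smul_apply, Matrix.one_apply]
  -- Differentiate a · adj(a) = det(a) · 1 and sum over `j`: only `j = i` survives, giving the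
  -- derivative of det a along `v i`. Jacobi's formula and `hsymm` rewrite it as the terms of the
  -- product rule in which `a` is differentiated.
  have h3 : ∀ i, ∑ j, fderiv ℝ (fun y => ∑ k, a y i k * (a y).adjugate k j) z (v j) =
      ∑ j, ∑ k, (a z).adjugate k j * fderiv ℝ (fun y => a y i k) z (v j) := by
    intro i
    rw [Finset.sum_eq_single i]
    · simp only [h2, if_true]
      rw [(hasFDerivAt_det fun i k => (ha i k).hasFDerivAt).fderiv]
      simp only [sum_apply, smul_apply, smul_eq_mul]
      exact Finset.sum_congr rfl fun j _ => Finset.sum_congr rfl fun k _ => by rw [hsymm]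
    · intro j _ hj
      simp [h2, hj.symm]
    · simp
  -- Those terms cancel against the product rule `h1`, so `a z` annihilates the vector of
  -- divergences; as `a z` is invertible, that vector is zero.
  have h4 : (a z).mulVec (fun k => ∑ j, fderiv ℝ (fun y => (a y).adjugate k j) z (v j)) = 0 := by
    funext i
    have := h3 i
    simp only [h1, Finset.sum_add_distrib] at this
    rw [add_eq_right, Finset.sum_comm] at this
    simpa [Matrix.mulVec, dotProduct, Finset.mul_sum] using this
  exact congrFun (Matrix.eq_zero_of_mulVec_eq_zero hdet h4) k

/-- Invariance of the divergence of a vector density under a change of coordinates with Jacobian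
matrix `a`. -/
theorem sum_fderiv_eq_of_change {a : X → Matrix n n ℝ} {z : X} {v v' : n → X} {F F' : n → X → V}
    (ha : ∀ i k, DifferentiableAt ℝ (fun y => a y i k) z) (hdet : (a z).det ≠ 0)
    (hsymm : ∀ i j k, fderiv ℝ (fun y => a y i k) z (v' j) = fderiv ℝ (fun y => a y j k) z (v' i))
    (hv : ∀ i, v' i = ∑ k, a z i k • v k) (hF : ∀ k, DifferentiableAt ℝ (F k) z)
    (hF' : ∀ i, F' i =ᶠ[nhds z] fun y => ∑ k, (|(a y).det| * (a y)⁻¹ k i) • F k y) :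
    ∑ i, fderiv ℝ (F' i) z (v' i) = |(a z).det| • ∑ k, fderiv ℝ (F k) z (v k) := by
  -- The sign of det a is constant near `z`, so |det a| is a constant multiple of det a and |det a|
  -- a⁻¹ is `s` times the adjugate.
  obtain ⟨s, hs⟩ : ∃ s : ℝ, ∀ᶠ y in nhds z, |(a y).det| = s * (a y).det := by
    have hcont := (differentiableAt_det ha).continuousAt
    rcases lt_or_gt_of_ne hdet with h | h
    · refine ⟨-1, ?_⟩
      filter_upwards [hcont.eventually_lt_const h] with y hy
      rw [abs_of_neg hy, neg_one_mul]
    · refine ⟨1, ?_⟩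
      filter_upwards [hcont.eventually_const_lt h] with y hy
      rw [abs_of_pos hy, one_mul]
  have hne : ∀ᶠ y in nhds z, (a y).det ≠ 0 := (differentiableAt_det ha).continuousAt.eventually_ne hdet
  have hc := differentiableAt_adjugate ha
  have h1 : ∀ i, F' i =ᶠ[nhds z] fun y => ∑ k, s • ((a y).adjugate k i • F k y) := by
    intro i
    filter_upwards [hF' i, hs, hne] with y h1 h2 h3
    rw [h1]
    refine Finset.sum_congr rfl fun k _ => ?_
    rw [h2, Matrix.inv_def, smul_smul]
    congr 1
    simp [Ring.inverse_eq_inv']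
    field_simp
  have h2 : ∀ i, fderiv ℝ (F' i) z (v' i) =
      s • ∑ k, ((a z).adjugate k i • fderiv ℝ (F k) z (v' i) +
        fderiv ℝ (fun y => (a y).adjugate k i) z (v' i) • F k z) := by
    intro i
    have h : HasFDerivAt (fun y => ∑ k, s • ((a y).adjugate k i • F k y)) _ z :=
      HasFDerivAt.fun_sum fun k _ =>
        ((hc k i).hasFDerivAt.fun_smul (hF k).hasFDerivAt).fun_const_smul s
    rw [(h1 i).fderiv_eq, h.fderiv, Finset.smul_sum]
    simp
  -- The terms in which the adjugate is differentiated add up to zero by Piola's identity.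
  have h3 : ∑ i, ∑ k, fderiv ℝ (fun y => (a y).adjugate k i) z (v' i) • F k z = 0 := by
    rw [Finset.sum_comm]
    refine Finset.sum_eq_zero fun k _ => ?_
    rw [← Finset.sum_smul, sum_fderiv_adjugate_eq_zero ha hdet hsymm, zero_smul]
  -- Expanding `v' i` in the `v l` contracts the adjugate with `a`, leaving the determinant.
  have h4 : ∑ i, ∑ k, (a z).adjugate k i • fderiv ℝ (F k) z (v' i) =
      (a z).det • ∑ k, fderiv ℝ (F k) z (v k) := by
    rw [Finset.sum_comm, Finset.smul_sum]
    refine Finset.sum_congr rfl fun k _ => ?_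
    simp only [hv, map_sum, map_smul, Finset.smul_sum, smul_smul]
    rw [Finset.sum_comm]
    simp only [← Finset.sum_smul]
    have h5 : ∀ l, ∑ i, (a z).adjugate k i * a z i l = if k = l then (a z).det else 0 := by
      intro l
      have := congrFun₂ (Matrix.adjugate_mul (a z)) k l
      rw [Matrix.mul_apply] at this
      simp [this, Matrix.smul_apply, Matrix.one_apply]
    simp [h5]
  rw [hs.self_of_nhds]
  simp only [h2, ← Finset.smul_sum, Finset.sum_add_distrib, h3, h4, add_zero, smul_smul]

end Piola

end EYM

namespace EYM

/-! ### Smoothness of determinants and inverse matrices -/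

section MatrixSmoothness

variable {EW HW W n : Type*} [NormedAddCommGroup EW] [NormedSpace ℝ EW]
  [TopologicalSpace HW] {J : ModelWithCorners ℝ EW HW} [TopologicalSpace W] [ChartedSpace HW W]
  [Fintype n] [DecidableEq n]

theorem contMDiffAt_matrix_det {a : W → Matrix n n ℝ} {w₀ : W}
    (ha : ∀ i k, ContMDiffAt J 𝓘(ℝ, ℝ) ∞ (fun w => a w i k) w₀) :
    ContMDiffAt J 𝓘(ℝ, ℝ) ∞ (fun w => (a w).det) w₀ := by
  simp only [Matrix.det_apply']
  exact contMDiffAt_finsetSum fun σ _ =>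
    contMDiffAt_const.mul (contMDiffAt_finsetProd fun i _ => ha _ _)

theorem contMDiffAt_matrix_inv {a : W → Matrix n n ℝ} {w₀ : W}
    (ha : ∀ i k, ContMDiffAt J 𝓘(ℝ, ℝ) ∞ (fun w => a w i k) w₀) (hdet : (a w₀).det ≠ 0)
    (i j : n) : ContMDiffAt J 𝓘(ℝ, ℝ) ∞ (fun w => (a w)⁻¹ i j) w₀ := by
  simp only [Matrix.inv_def, Matrix.smul_apply, Ring.inverse_eq_inv', smul_eq_mul,
    Matrix.adjugate_apply]
  refine ((contMDiffAt_matrix_det ha).inv₀ hdet).mul (contMDiffAt_matrix_det fun k l => ?_)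
  by_cases h : k = j
  · subst h
    simpa using contMDiffAt_const
  · simpa [Matrix.updateRow_ne h] using ha k l

end MatrixSmoothness

/-! ### Coordinate fields, Gram matrices and the metric density -/

section ChartFields

variable {EM M : Type*} [NormedAddCommGroup EM] [NormedSpace ℝ EM] [TopologicalSpace M]
  [ChartedSpace EM M] [IsManifold 𝓘(ℝ, EM) ∞ M]
  {EW HW W : Type*} [NormedAddCommGroup EW] [NormedSpace ℝ EW]
  [TopologicalSpace HW] {J : ModelWithCorners ℝ EW HW} [TopologicalSpace W] [ChartedSpace HW W]

omit [IsManifold 𝓘(ℝ, EM) ∞ M] in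
theorem extChartAt_symm_apply_of_mem {c x : M} (hx : x ∈ (chartAt EM c).source) :
    (extChartAt 𝓘(ℝ, EM) c).symm (extChartAt 𝓘(ℝ, EM) c x) = x :=
  (extChartAt 𝓘(ℝ, EM) c).left_inv (by simpa using hx)

theorem contMDiffAt_tangentVector_modelSpace {b v : W → EM} {w₀ : W}
    (hb : ContMDiffAt J 𝓘(ℝ, EM) ∞ b w₀) (hv : ContMDiffAt J 𝓘(ℝ, EM) ∞ v w₀) :
    ContMDiffAt J 𝓘(ℝ, EM).tangent ∞
      (fun w => (⟨b w, v w⟩ : TangentBundle 𝓘(ℝ, EM) EM)) w₀ := by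
  refine Bundle.contMDiffAt_totalSpace.2 ⟨hb, ?_⟩
  refine hv.congr_of_eventuallyEq (Filter.Eventually.of_forall fun w => ?_)
  simp

theorem contMDiffAt_extChartAt_symm_of_mem {c x : M} (hx : x ∈ (chartAt EM c).source) :
    ContMDiffAt 𝓘(ℝ, EM) 𝓘(ℝ, EM) ∞ (extChartAt 𝓘(ℝ, EM) c).symm (extChartAt 𝓘(ℝ, EM) c x) :=
  (contMDiffOn_extChartAt_symm c).contMDiffAt
    ((isOpen_extChartAt_target c).mem_nhds
      ((extChartAt 𝓘(ℝ, EM) c).map_source (by simpa using hx)))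

theorem mfderiv_extChartAt_symm_injective {c x : M} (hx : x ∈ (chartAt EM c).source) :
    Function.Injective (mfderiv 𝓘(ℝ, EM) 𝓘(ℝ, EM) (extChartAt 𝓘(ℝ, EM) c).symm
      (extChartAt 𝓘(ℝ, EM) c x)) := by
  have h := isInvertible_mfderivWithin_extChartAt_symm (I := 𝓘(ℝ, EM))
    ((extChartAt 𝓘(ℝ, EM) c).map_source (by simpa using hx : x ∈ (extChartAt 𝓘(ℝ, EM) c).source))
  simp only [modelWithCornersSelf_coe, Set.range_id, mfderivWithin_univ] at h
  exact h.injective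

namespace PrincipalBundle

/-- The transition map from the chart centred at `c'` to the chart centred at `c`. -/
noncomputable def transition (c c' : M) (y : EM) : EM :=
  extChartAt 𝓘(ℝ, EM) c ((extChartAt 𝓘(ℝ, EM) c').symm y)

theorem contDiffAt_transition {c c' x : M} (hx : x ∈ (chartAt EM c).source)
    (hx' : x ∈ (chartAt EM c').source) :
    ContDiffAt ℝ ∞ (transition c c') (extChartAt 𝓘(ℝ, EM) c' x) := by
  rw [← contMDiffAt_iff_contDiffAt]
  refine ContMDiffAt.comp _ ?_ (contMDiffAt_extChartAt_symm_of_mem hx')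
  rw [extChartAt_symm_apply_of_mem hx']
  exact contMDiffAt_extChartAt' hx

variable [FiniteDimensional ℝ EM]

theorem contMDiffAt_coordField {c : M} {b : W → M} {w₀ : W} (i : Fin (Module.finrank ℝ EM))
    (hc : b w₀ ∈ (chartAt EM c).source) (hb : ContMDiffAt J 𝓘(ℝ, EM) ∞ b w₀) [IsManifold J ∞ W] :
    ContMDiffAt J 𝓘(ℝ, EM).tangent ∞
      (fun w => (⟨b w, coordField c i (b w)⟩ : TangentBundle 𝓘(ℝ, EM) M)) w₀ := by
  have h1 : ContMDiffAt J 𝓘(ℝ, EM) ∞ (fun w => extChartAt 𝓘(ℝ, EM) c (b w)) w₀ :=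
    (contMDiffAt_extChartAt' hc).comp w₀ hb
  have h := contMDiffAt_mfderiv_family
    (φ := fun (_ : W) => ((extChartAt 𝓘(ℝ, EM) c).symm : EM → M))
    (b := fun w => extChartAt 𝓘(ℝ, EM) c (b w)) (v := fun _ => Module.finBasis ℝ EM i)
    (w₀ := w₀) (J := J) (N' := M) (E' := EM) (E := EM)
    ((contMDiffAt_extChartAt_symm_of_mem hc).comp (w₀, _) contMDiffAt_snd)
    (contMDiffAt_tangentVector_modelSpace h1 contMDiffAt_const)
  refine h.congr_of_eventuallyEq ?_
  filter_upwards [hb.continuousAt.preimage_mem_nhds ((chartAt EM c).open_source.mem_nhds hc)]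
    with w hw
  exact tangentBundle_mk_eq (extChartAt_symm_apply_of_mem hw).symm rfl

theorem contMDiffAt_gram (g : Metric EM M) {c x : M} (hx : x ∈ (chartAt EM c).source)
    (i j : Fin (Module.finrank ℝ EM)) :
    ContMDiffAt 𝓘(ℝ, EM) 𝓘(ℝ, ℝ) ∞ (fun y => gram g c y i j) x := by
  have hi := contMDiffAt_coordField i hx (contMDiffAt_id (I := 𝓘(ℝ, EM)))
  have hj := contMDiffAt_coordField j hx (contMDiffAt_id (I := 𝓘(ℝ, EM)))
  have h : ContMDiffAt 𝓘(ℝ, EM) (𝓘(ℝ, EM).prod 𝓘(ℝ, ℝ)) ∞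
      (fun y => Bundle.TotalSpace.mk' ℝ (E := Bundle.Trivial M ℝ) y
        (g.inner y (coordField c i y) (coordField c j y))) x :=
    ContMDiffAt.clm_bundle_apply₂ (F₁ := EM) (F₂ := EM) g.contMDiff.contMDiffAt hi hj
  exact (Bundle.contMDiffAt_totalSpace.1 h).2

/-- The coordinate fields at `x` are the image of a basis under an injective map, so a nonzero
coefficient vector gives a nonzero tangent vector, on which the metric is positive. -/
theorem gram_posDef (g : Metric EM M) {c x : M} (hx : x ∈ (chartAt EM c).source) :
    (gram g c x).PosDef := by
  refine Matrix.PosDef.of_dotProduct_mulVec_pos ?_ ?_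
  · ext i j
    exact g.symm x _ _
  · intro a ha
    let L : EM →L[ℝ] EM := mfderiv 𝓘(ℝ, EM) 𝓘(ℝ, EM) (extChartAt 𝓘(ℝ, EM) c).symm
      (extChartAt 𝓘(ℝ, EM) c x)
    have hL : Function.Injective L := mfderiv_extChartAt_symm_injective hx
    have h1 : L (∑ i, a i • Module.finBasis ℝ EM i) ≠ 0 := by
      rw [Ne, map_eq_zero_iff _ hL]
      intro h0
      exact ha (funext fun i =>
        Fintype.linearIndependent_iff.1 (Module.finBasis ℝ EM).linearIndependent a h0 i)
    have h2 := g.pos x _ h1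
    have h3 : ∀ i j, g.inner x (L (Module.finBasis ℝ EM i)) (L (Module.finBasis ℝ EM j)) =
      gram g c x i j := fun i j => rfl
    let b : EM →L[ℝ] EM →L[ℝ] ℝ := g.inner x
    have h4 : b (L (∑ i, a i • Module.finBasis ℝ EM i)) (L (∑ i, a i • Module.finBasis ℝ EM i)) =
      star a ⬝ᵥ (gram g c x).mulVec a := by
      have h5 : ∀ i j, b (L (Module.finBasis ℝ EM i)) (L (Module.finBasis ℝ EM j)) =
        gram g c x i j := h3
      simp only [map_sum, map_smul, sum_apply, smul_apply, h5, smul_eq_mul, Matrix.mulVec,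
        dotProduct, Finset.mul_sum, star_trivial]
      rw [Finset.sum_comm]
      exact Finset.sum_congr rfl fun i _ => Finset.sum_congr rfl fun j _ => by ring
    rw [← h4]
    exact h2

theorem gram_det_pos (g : Metric EM M) {c x : M} (hx : x ∈ (chartAt EM c).source) :
    0 < (gram g c x).det :=
  (gram_posDef g hx).det_pos

/-- The density `√|g| g^{ij}`, in the chart centred at `c`. -/
noncomputable def metricDensity (g : Metric EM M) (c x : M) (i j : Fin (Module.finrank ℝ EM)) : ℝ :=
  Real.sqrt (gram g c x).det * (gram g c x)⁻¹ i j

theorem contMDiffAt_sqrt_gram_det (g : Metric EM M) {c x : M} (hx : x ∈ (chartAt EM c).source) :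
    ContMDiffAt 𝓘(ℝ, EM) 𝓘(ℝ, ℝ) ∞ (fun y => Real.sqrt (gram g c y).det) x :=
  ((Real.contDiffAt_sqrt (gram_det_pos g hx).ne').contMDiffAt).comp x
    (contMDiffAt_matrix_det fun i j => contMDiffAt_gram g hx i j)

theorem contMDiffAt_metricDensity (g : Metric EM M) {c x : M} (hx : x ∈ (chartAt EM c).source)
    (i j : Fin (Module.finrank ℝ EM)) :
    ContMDiffAt 𝓘(ℝ, EM) 𝓘(ℝ, ℝ) ∞ (fun y => metricDensity g c y i j) x :=
  (contMDiffAt_sqrt_gram_det g hx).mul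
    (contMDiffAt_matrix_inv (fun i j => contMDiffAt_gram g hx i j) (gram_det_pos g hx).ne' i j)

variable (EM) in
/-- The Jacobian matrix of the transition map, as a function on the manifold. -/
noncomputable def transitionJacobian (c c' x : M) :
    Matrix (Fin (Module.finrank ℝ EM)) (Fin (Module.finrank ℝ EM)) ℝ :=
  Matrix.of fun i k => (Module.finBasis ℝ EM).coord k
    (fderiv ℝ (transition c c') (extChartAt 𝓘(ℝ, EM) c' x) (Module.finBasis ℝ EM i))

theorem coordField_eq_sum {c c' x : M} (hx : x ∈ (chartAt EM c).source)
    (hx' : x ∈ (chartAt EM c').source) (i : Fin (Module.finrank ℝ EM)) :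
    coordField c' i x = ∑ k, transitionJacobian EM c c' x i k • coordField c k x := by
  let y := extChartAt 𝓘(ℝ, EM) c' x
  have hy : transition c c' y = extChartAt 𝓘(ℝ, EM) c x :=
    congrArg _ (extChartAt_symm_apply_of_mem hx')
  have h1 : (extChartAt 𝓘(ℝ, EM) c').symm =ᶠ[nhds y]
      (extChartAt 𝓘(ℝ, EM) c).symm ∘ transition c c' := by
    have := (contMDiffAt_extChartAt_symm_of_mem hx').continuousAt.preimage_mem_nhds
      ((chartAt EM c).open_source.mem_nhds (by rwa [extChartAt_symm_apply_of_mem hx']))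
    filter_upwards [this] with z hz
    exact (extChartAt_symm_apply_of_mem hz).symm
  have h2 : MDifferentiableAt 𝓘(ℝ, EM) 𝓘(ℝ, EM) (extChartAt 𝓘(ℝ, EM) c).symm (transition c c' y) := by
    rw [hy]
    exact (contMDiffAt_extChartAt_symm_of_mem hx).mdifferentiableAt (by simp)
  have h3 : MDifferentiableAt 𝓘(ℝ, EM) 𝓘(ℝ, EM) (transition c c') y :=
    ((contDiffAt_transition hx hx').differentiableAt (by simp)).mdifferentiableAt
  have h4 := mfderiv_comp_apply y h2 h3 (Module.finBasis ℝ EM i)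
  have h5 : (mfderiv 𝓘(ℝ, EM) 𝓘(ℝ, EM) (transition c c') y (Module.finBasis ℝ EM i) : EM) =
      ∑ k, transitionJacobian EM c c' x i k • Module.finBasis ℝ EM k := by
    rw [mfderiv_eq_fderiv]
    exact ((Module.finBasis ℝ EM).sum_repr _).symm
  let L : EM →L[ℝ] EM := mfderiv 𝓘(ℝ, EM) 𝓘(ℝ, EM) (extChartAt 𝓘(ℝ, EM) c).symm
    (transition c c' y)
  have h6 : ∀ k, L (Module.finBasis ℝ EM k) = coordField c k x := by
    intro k
    have : ∀ z, z = extChartAt 𝓘(ℝ, EM) c x → (mfderiv 𝓘(ℝ, EM) 𝓘(ℝ, EM)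
        (extChartAt 𝓘(ℝ, EM) c).symm z (Module.finBasis ℝ EM k) : EM) = coordField c k x := by
      rintro _ rfl
      rfl
    exact this _ hy
  have h7 : coordField c' i x = L (∑ k, transitionJacobian EM c c' x i k • Module.finBasis ℝ EM k) := by
    refine Eq.trans ?_ (congrArg L h5)
    exact (congrArg (fun K : EM →L[ℝ] EM => K (Module.finBasis ℝ EM i))
      (h1.mfderiv_eq (I := 𝓘(ℝ, EM)) (I' := 𝓘(ℝ, EM)))).trans h4
  rw [h7, map_sum]
  refine Finset.sum_congr rfl fun k _ => ?_
  rw [map_smul, h6]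
  rfl

theorem gram_eq_mul (g : Metric EM M) {c c' x : M} (hx : x ∈ (chartAt EM c).source)
    (hx' : x ∈ (chartAt EM c').source) :
    gram g c' x = transitionJacobian EM c c' x * gram g c x * (transitionJacobian EM c c' x).transpose := by
  ext i j
  change g.inner x (coordField c' i x) (coordField c' j x) = _
  rw [coordField_eq_sum hx hx' i, coordField_eq_sum hx hx' j]
  simp only [map_sum, map_smul, sum_apply, smul_apply, Matrix.mul_apply, smul_eq_mul,
    Matrix.transpose_apply, Finset.sum_mul, Finset.mul_sum]
  refine Finset.sum_congr rfl fun k _ => Finset.sum_congr rfl fun l _ => ?_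
  change _ = transitionJacobian EM c c' x i l * g.inner x (coordField c l x) (coordField c k x) * _
  ring

/-- Read off from g' = a g aᵀ, whose determinant is positive. -/
theorem transitionJacobian_det_ne_zero (g : Metric EM M) {c c' x : M}
    (hx : x ∈ (chartAt EM c).source) (hx' : x ∈ (chartAt EM c').source) :
    (transitionJacobian EM c c' x).det ≠ 0 := by
  have h := (gram_det_pos g hx').ne'
  rw [gram_eq_mul g hx hx', Matrix.det_mul, Matrix.det_mul] at h
  exact left_ne_zero_of_mul (left_ne_zero_of_mul h)

theorem sqrt_gram_det_eq (g : Metric EM M) {c c' x : M} (hx : x ∈ (chartAt EM c).source)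
    (hx' : x ∈ (chartAt EM c').source) :
    Real.sqrt (gram g c' x).det =
      |(transitionJacobian EM c c' x).det| * Real.sqrt (gram g c x).det := by
  rw [gram_eq_mul g hx hx', Matrix.det_mul, Matrix.det_mul, Matrix.det_transpose,
    mul_right_comm, ← sq, Real.sqrt_mul (sq_nonneg _), Real.sqrt_sq_eq_abs]

/-- This is (g')⁻¹ a = (a⁻¹)ᵀ g⁻¹ multiplied by √|g'| = |det a| √|g|. It is the transformation law
that makes √|g| g^{ij} Y_j a vector density. -/
theorem sum_metricDensity_mul (g : Metric EM M) {c c' x : M} (hx : x ∈ (chartAt EM c).source)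
    (hx' : x ∈ (chartAt EM c').source) (i l : Fin (Module.finrank ℝ EM)) :
    ∑ j, metricDensity g c' x i j * transitionJacobian EM c c' x j l =
      ∑ k, |(transitionJacobian EM c c' x).det| * (transitionJacobian EM c c' x)⁻¹ k i *
        metricDensity g c x k l := by
  set a := transitionJacobian EM c c' x with ha
  have hdet : IsUnit a.det := (transitionJacobian_det_ne_zero g hx hx').isUnit
  have h1 : (gram g c' x)⁻¹ * a = (a⁻¹).transpose * (gram g c x)⁻¹ := by
    rw [gram_eq_mul g hx hx', Matrix.mul_inv_rev, Matrix.mul_inv_rev, ← ha, Matrix.mul_assoc,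
      Matrix.mul_assoc, Matrix.nonsing_inv_mul _ hdet, Matrix.mul_one, Matrix.transpose_nonsing_inv]
  have h2 := congrFun₂ h1 i l
  rw [Matrix.mul_apply, Matrix.mul_apply] at h2
  simp only [metricDensity, sqrt_gram_det_eq g hx hx', ← ha]
  have h3 := congrArg (fun r => |a.det| * Real.sqrt (gram g c x).det * r) h2
  simp only [Finset.mul_sum, Matrix.transpose_apply] at h3
  simp only [← mul_assoc] at h3 ⊢
  rw [h3]
  exact Finset.sum_congr rfl fun k _ => by ring

end PrincipalBundle

end ChartFields

end EYM

namespace EYM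

/-- The derivative of a vector-valued function along a tangent vector, as a plain vector. -/
noncomputable def dirDeriv {E N V : Type*} [NormedAddCommGroup E] [NormedSpace ℝ E]
    [TopologicalSpace N] [ChartedSpace E N] [NormedAddCommGroup V] [NormedSpace ℝ V] (f : N → V)
    (p : N) (u : TangentSpace 𝓘(ℝ, E) p) : V :=
  mfderiv 𝓘(ℝ, E) 𝓘(ℝ, V) f p u

/-- Passage to a chart, in order to apply Piola's identity, which is stated on a normed space. -/
theorem mfderiv_vector_eq_fderiv {E N V : Type*} [NormedAddCommGroup E] [NormedSpace ℝ E]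
    [TopologicalSpace N] [ChartedSpace E N] [IsManifold 𝓘(ℝ, E) ∞ N] [NormedAddCommGroup V]
    [NormedSpace ℝ V] {f : N → V} {p : N} (hf : MDifferentiableAt 𝓘(ℝ, E) 𝓘(ℝ, V) f p) (v : E) :
    (mfderiv 𝓘(ℝ, E) 𝓘(ℝ, V) f p v : V) =
      fderiv ℝ (f ∘ (extChartAt 𝓘(ℝ, E) p).symm) (extChartAt 𝓘(ℝ, E) p p) v := by
  rw [hf.mfderiv]
  simp only [modelWithCornersSelf_coe, Set.range_id, fderivWithin_univ]
  rfl

theorem ContMDiffAt.differentiableAt_comp_extChartAt_symm {E N V : Type*} [NormedAddCommGroup E]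
    [NormedSpace ℝ E] [TopologicalSpace N] [ChartedSpace E N] [IsManifold 𝓘(ℝ, E) ∞ N]
    [NormedAddCommGroup V] [NormedSpace ℝ V] {f : N → V} {p : N}
    (hf : ContMDiffAt 𝓘(ℝ, E) 𝓘(ℝ, V) ∞ f p) :
    DifferentiableAt ℝ (f ∘ (extChartAt 𝓘(ℝ, E) p).symm) (extChartAt 𝓘(ℝ, E) p p) := by
  have h : ContMDiffAt 𝓘(ℝ, E) 𝓘(ℝ, V) ∞ (f ∘ (extChartAt 𝓘(ℝ, E) p).symm)
      (extChartAt 𝓘(ℝ, E) p p) := by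
    refine ContMDiffAt.comp _ ?_ (contMDiffAt_extChartAt_symm_of_mem (mem_chart_source E p))
    rwa [extChartAt_symm_apply_of_mem (mem_chart_source E p)]
  exact h.contDiffAt.differentiableAt (by simp)

theorem contMDiffAt_dirDeriv_family {E N V T : Type*} [NormedAddCommGroup E]
    [NormedSpace ℝ E] [TopologicalSpace N] [ChartedSpace E N] [IsManifold 𝓘(ℝ, E) ∞ N]
    [NormedAddCommGroup V] [NormedSpace ℝ V] [NormedAddCommGroup T] [NormedSpace ℝ T]
    {F : T → N → V} {v : ∀ y : T × N, TangentSpace 𝓘(ℝ, E) y.2} {t : T} {p : N}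
    (hF : ContMDiffAt (𝓘(ℝ, T).prod 𝓘(ℝ, E)) 𝓘(ℝ, V) ∞ (fun y : T × N => F y.1 y.2) (t, p))
    (hv : ContMDiffAt (𝓘(ℝ, T).prod 𝓘(ℝ, E)) 𝓘(ℝ, E).tangent ∞
      (fun y : T × N => (⟨y.2, v y⟩ : TangentBundle 𝓘(ℝ, E) N)) (t, p)) :
    ContMDiffAt (𝓘(ℝ, T).prod 𝓘(ℝ, E)) 𝓘(ℝ, V) ∞
      (fun y : T × N => dirDeriv (F y.1) y.2 (v y)) (t, p) := by
  have h1 : ContMDiffAt ((𝓘(ℝ, T).prod 𝓘(ℝ, E)).prod 𝓘(ℝ, E)) (𝓘(ℝ, T).prod 𝓘(ℝ, E)) ∞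
      (fun y : (T × N) × N => (y.1.1, y.2)) ((t, p), p) :=
    (contMDiffAt_fst.comp ((t, p), p) contMDiffAt_fst).prodMk contMDiffAt_snd
  have h2 : ContMDiffAt ((𝓘(ℝ, T).prod 𝓘(ℝ, E)).prod 𝓘(ℝ, E)) 𝓘(ℝ, V) ∞
      (Function.uncurry fun (y : T × N) (q : N) => F y.1 q) ((t, p), p) :=
    ContMDiffAt.comp (g := fun y : T × N => F y.1 y.2) ((t, p), p) hF h1
  exact contMDiffAt_mfderiv_family_vector (w₀ := (t, p)) (b := fun y : T × N => y.2) h2 hv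

namespace PrincipalBundle

/-! ### Second derivatives of chart transitions -/

section Transition

variable {EM M : Type*} [NormedAddCommGroup EM] [NormedSpace ℝ EM] [TopologicalSpace M]
  [ChartedSpace EM M] [IsManifold 𝓘(ℝ, EM) ∞ M] [FiniteDimensional ℝ EM]

theorem mfderiv_extChartAt_coordField {c x : M} (hx : x ∈ (chartAt EM c).source)
    (i : Fin (Module.finrank ℝ EM)) :
    (mfderiv 𝓘(ℝ, EM) 𝓘(ℝ, EM) (extChartAt 𝓘(ℝ, EM) c) x (coordField c i x) : EM) =
      Module.finBasis ℝ EM i := by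
  have h := mfderiv_extChartAt_comp_mfderivWithin_extChartAt_symm' (I := 𝓘(ℝ, EM))
    (by simpa using hx : x ∈ (extChartAt 𝓘(ℝ, EM) c).source)
  simp only [modelWithCornersSelf_coe, Set.range_id, mfderivWithin_univ] at h
  exact congrArg (fun L : EM →L[ℝ] EM => L (Module.finBasis ℝ EM i)) h

/-- The entries of the Jacobian of the transition map, as functions of the coordinates. -/
theorem contDiffAt_fderiv_transition {c c' x : M} (hx : x ∈ (chartAt EM c).source)
    (hx' : x ∈ (chartAt EM c').source) (i k : Fin (Module.finrank ℝ EM)) :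
    ContDiffAt ℝ ∞ (fun y => (Module.finBasis ℝ EM).coord k
      (fderiv ℝ (transition c c') y (Module.finBasis ℝ EM i))) (extChartAt 𝓘(ℝ, EM) c' x) := by
  have h : ContDiffAt ℝ ∞ (fderiv ℝ (transition c c')) (extChartAt 𝓘(ℝ, EM) c' x) :=
    (contDiffAt_transition hx hx').fderiv_right le_rfl
  exact (((Module.finBasis ℝ EM).coord k).toContinuousLinearMap.contDiff.contDiffAt).comp _
    (h.clm_apply contDiffAt_const)

theorem contMDiffAt_transitionJacobian {c c' x : M} (hx : x ∈ (chartAt EM c).source)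
    (hx' : x ∈ (chartAt EM c').source) (i k : Fin (Module.finrank ℝ EM)) :
    ContMDiffAt 𝓘(ℝ, EM) 𝓘(ℝ, ℝ) ∞ (fun y => transitionJacobian EM c c' y i k) x :=
  (contDiffAt_fderiv_transition hx hx' i k).contMDiffAt.comp x (contMDiffAt_extChartAt' hx')

/-- In the chart centred at `c'` the coordinate fields are constant basis vectors, so both sides are
mixed second derivatives of the transition map. This supplies the symmetry hypothesis of Piola's
identity. -/
theorem mfderiv_transitionJacobian_symm {c c' x : M} (hx : x ∈ (chartAt EM c).source)
    (hx' : x ∈ (chartAt EM c').source) (i j k : Fin (Module.finrank ℝ EM)) :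
    (mfderiv 𝓘(ℝ, EM) 𝓘(ℝ, ℝ) (fun y => transitionJacobian EM c c' y i k) x
      (coordField c' j x) : ℝ) =
    mfderiv 𝓘(ℝ, EM) 𝓘(ℝ, ℝ) (fun y => transitionJacobian EM c c' y j k) x
      (coordField c' i x) := by
  have key : ∀ i j, (mfderiv 𝓘(ℝ, EM) 𝓘(ℝ, ℝ) (fun y => transitionJacobian EM c c' y i k) x
      (coordField c' j x) : ℝ) = (Module.finBasis ℝ EM).coord k
        (fderiv ℝ (fderiv ℝ (transition c c')) (extChartAt 𝓘(ℝ, EM) c' x)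
          (Module.finBasis ℝ EM j) (Module.finBasis ℝ EM i)) := by
    intro i j
    have h1 := mfderiv_comp_apply x (I := 𝓘(ℝ, EM)) (I' := 𝓘(ℝ, EM)) (I'' := 𝓘(ℝ, ℝ))
      ((contDiffAt_fderiv_transition hx hx' i k).contMDiffAt.mdifferentiableAt (by simp))
      ((contMDiffAt_extChartAt' (n := ∞) hx').mdifferentiableAt (by simp)) (coordField c' j x)
    refine h1.trans ?_
    rw [mfderiv_eq_fderiv]
    refine (congrArg _ (mfderiv_extChartAt_coordField hx' j)).trans ?_
    have h2 : DifferentiableAt ℝ (fderiv ℝ (transition c c')) (extChartAt 𝓘(ℝ, EM) c' x) :=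
      ((contDiffAt_transition hx hx').fderiv_right (m := ∞) le_rfl).differentiableAt (by simp)
    have h3 := (((Module.finBasis ℝ EM).coord k).toContinuousLinearMap.hasFDerivAt
      (x := fderiv ℝ (transition c c') (extChartAt 𝓘(ℝ, EM) c' x) (Module.finBasis ℝ EM i))).comp
      (extChartAt 𝓘(ℝ, EM) c' x)
      (h2.hasFDerivAt.clm_apply (hasFDerivAt_const (Module.finBasis ℝ EM i) _))
    refine (congrArg (fun L : EM →L[ℝ] ℝ => L (Module.finBasis ℝ EM j)) h3.fderiv).trans ?_
    simp
  rw [key, key]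
  refine congrArg _ ?_
  exact ((contDiffAt_transition hx hx').isSymmSndFDerivAt (by
    rw [minSmoothness_of_isRCLikeNormedField]
    exact WithTop.coe_le_coe.2 (le_top : (2 : ℕ∞) ≤ ⊤))) _ _

end Transition

/-! ### Chart independence, smoothness and equivariance of the codifferential -/

section Codifferential

variable {EG EP EM G P M T : Type*}
  [NormedAddCommGroup EG] [NormedSpace ℝ EG] [NormedAddCommGroup EP] [NormedSpace ℝ EP]
  [NormedAddCommGroup EM] [NormedSpace ℝ EM] [FiniteDimensional ℝ EM]
  [TopologicalSpace G] [ChartedSpace EG G] [Group G] [LieGroup 𝓘(ℝ, EG) ∞ G]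
  [TopologicalSpace P] [ChartedSpace EP P] [IsManifold 𝓘(ℝ, EP) ∞ P]
  [TopologicalSpace M] [ChartedSpace EM M] [IsManifold 𝓘(ℝ, EM) ∞ M]
  [MulAction Gᵐᵒᵖ P] {B : PrincipalBundle EG EP EM G P M}
  [NormedAddCommGroup T] [NormedSpace ℝ T]

/-- The vector density `√|g| g^{ij} Y_j` of which the codifferential is minus the covariant
divergence, in the chart centred at `c`. -/
noncomputable def flux (g : Metric EM M) (A : B.Connection) (Y : B.HorizontalForm) (c : M)
    (i : Fin (Module.finrank ℝ EM)) (q : P) : EG :=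
  ∑ j, metricDensity g c (B.proj q) i j • Y.toFun q (A.hor q (coordField c j (B.proj q)))

/-- The covariant codifferential, computed in the chart centred at `c`. -/
noncomputable def codiffIn (g : Metric EM M) (A : B.Connection) (Y : B.HorizontalForm) (c : M)
    (p : P) : EG :=
  -∑ i, (Real.sqrt (gram g c (B.proj p)).det)⁻¹ •
    dirDeriv (flux g A Y c i) p (A.hor p (coordField c i (B.proj p)))

theorem codiff_eq_codiffIn (g : Metric EM M) (A : B.Connection) (Y : B.HorizontalForm) (p : P) :
    codiff g A Y p = codiffIn g A Y (B.proj p) p := rfl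

/-- The covector components Y_j change by the Jacobian; combined with `sum_metricDensity_mul` this
gives the factor |det a| a⁻¹ required by `sum_fderiv_eq_of_change`. -/
theorem flux_change (g : Metric EM M) (A : B.Connection) (Y : B.HorizontalForm) {c c' : M} {q : P}
    (hq : B.proj q ∈ (chartAt EM c).source) (hq' : B.proj q ∈ (chartAt EM c').source)
    (i : Fin (Module.finrank ℝ EM)) :
    flux g A Y c' i q = ∑ k, (|(transitionJacobian EM c c' (B.proj q)).det| *
      (transitionJacobian EM c c' (B.proj q))⁻¹ k i) • flux g A Y c k q := by
  have h1 : ∀ j, Y.toFun q (A.hor q (coordField c' j (B.proj q))) =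
      ∑ l, transitionJacobian EM c c' (B.proj q) j l •
        Y.toFun q (A.hor q (coordField c l (B.proj q))) := by
    intro j
    rw [coordField_eq_sum hq hq' j]
    simp only [map_sum, map_smul]
  simp only [flux, h1, Finset.smul_sum, smul_smul]
  rw [Finset.sum_comm]
  conv_rhs => rw [Finset.sum_comm]
  refine Finset.sum_congr rfl fun l _ => ?_
  rw [← Finset.sum_smul, ← Finset.sum_smul, sum_metricDensity_mul g hq hq']

theorem codiff_neg (g : Metric EM M) (A : B.Connection) (Y : B.HorizontalForm) (p : P) :
    codiff g A Y.neg p = -codiff g A Y p := by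
  rw [codiff_eq_codiffIn, codiff_eq_codiffIn]
  have h : ∀ i, flux g A Y.neg (B.proj p) i = -flux g A Y (B.proj p) i := by
    intro i
    funext q
    change ∑ j, _ • -(Y.toFun q (A.hor q (coordField (B.proj p) j (B.proj q)))) = -∑ j, _
    simp only [smul_neg, Finset.sum_neg_distrib]
  have h' : ∀ i u, dirDeriv (flux g A Y.neg (B.proj p) i) p u =
      -dirDeriv (flux g A Y (B.proj p) i) p u := fun i u => by
    rw [h]
    exact congrArg (fun L : EP →L[ℝ] EG => L u) (mfderiv_neg (I := 𝓘(ℝ, EP)))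
  refine congrArg Neg.neg (Eq.trans ?_ (Finset.sum_neg_distrib _))
  exact Finset.sum_congr rfl fun i _ => (congrArg _ (h' i _)).trans (smul_neg _ _)

variable [FiniteDimensional ℝ EP]

theorem contMDiffAt_hor_coordField {A : T → B.Connection}
    (hA : IsSmoothFormFamily (fun t => (A t).toOneForm)) {c : M} {t : T} {p : P}
    (hp : B.proj p ∈ (chartAt EM c).source) (i : Fin (Module.finrank ℝ EM)) :
    ContMDiffAt (𝓘(ℝ, T).prod 𝓘(ℝ, EP)) 𝓘(ℝ, EP).tangent ∞
      (fun y : T × P => (⟨y.2, (A y.1).hor y.2 (coordField c i (B.proj y.2))⟩ :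
        TangentBundle 𝓘(ℝ, EP) P)) (t, p) :=
  contMDiffAt_hor hA contMDiffAt_fst contMDiffAt_snd
    (contMDiffAt_coordField (b := fun y : T × P => B.proj y.2) i hp
      (B.smooth_proj.comp contMDiff_snd).contMDiffAt)

theorem contMDiffAt_flux_family (g : Metric EM M) {A : T → B.Connection}
    {Y : T → B.HorizontalForm} (hA : IsSmoothFormFamily (fun t => (A t).toOneForm))
    (hY : IsSmoothFormFamily (fun t => (Y t).toOneForm)) {c : M} {t : T} {p : P}
    (hp : B.proj p ∈ (chartAt EM c).source) (i : Fin (Module.finrank ℝ EM)) :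
    ContMDiffAt (𝓘(ℝ, T).prod 𝓘(ℝ, EP)) 𝓘(ℝ, EG) ∞
      (fun y : T × P => flux g (A y.1) (Y y.1) c i y.2) (t, p) := by
  have h1 : ∀ j, ContMDiffAt (𝓘(ℝ, T).prod 𝓘(ℝ, EP)) 𝓘(ℝ, ℝ) ∞
      (fun y : T × P => metricDensity g c (B.proj y.2) i j) (t, p) := fun j =>
    (contMDiffAt_metricDensity g hp i j).comp (t, p) (B.smooth_proj.comp contMDiff_snd).contMDiffAt
  exact contMDiffAt_finsetSum fun j _ => (h1 j).smul
    (hY.contMDiffAt_apply contMDiffAt_fst (contMDiffAt_hor_coordField hA hp j))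

theorem contMDiffAt_flux (g : Metric EM M) (A : B.Connection) (Y : B.HorizontalForm) {c : M}
    {p : P} (hp : B.proj p ∈ (chartAt EM c).source) (i : Fin (Module.finrank ℝ EM)) :
    ContMDiffAt 𝓘(ℝ, EP) 𝓘(ℝ, EG) ∞ (flux g A Y c i) p :=
  (contMDiffAt_flux_family (T := ℝ) g (isSmoothFormFamily_const A.toOneForm)
    (isSmoothFormFamily_const Y.toOneForm) (t := 0) hp i).comp p
      (contMDiffAt_const.prodMk contMDiffAt_id)

theorem contMDiffAt_codiffIn_family (g : Metric EM M) {A : T → B.Connection}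
    {Y : T → B.HorizontalForm} (hA : IsSmoothFormFamily (fun t => (A t).toOneForm))
    (hY : IsSmoothFormFamily (fun t => (Y t).toOneForm)) {c : M} {t : T} {p : P}
    (hp : B.proj p ∈ (chartAt EM c).source) :
    ContMDiffAt (𝓘(ℝ, T).prod 𝓘(ℝ, EP)) 𝓘(ℝ, EG) ∞
      (fun y : T × P => codiffIn g (A y.1) (Y y.1) c y.2) (t, p) := by
  have h1 : ContMDiffAt (𝓘(ℝ, T).prod 𝓘(ℝ, EP)) 𝓘(ℝ, ℝ) ∞
      (fun y : T × P => (Real.sqrt (gram g c (B.proj y.2)).det)⁻¹) (t, p) := by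
    have h : ContMDiffAt (𝓘(ℝ, T).prod 𝓘(ℝ, EP)) 𝓘(ℝ, ℝ) ∞
        (fun y : T × P => Real.sqrt (gram g c (B.proj y.2)).det) (t, p) :=
      ContMDiffAt.comp (g := fun x => Real.sqrt (gram g c x).det) (t, p)
        (contMDiffAt_sqrt_gram_det g hp) (B.smooth_proj.comp contMDiff_snd).contMDiffAt
    exact h.inv₀ (Real.sqrt_pos.2 (gram_det_pos g hp)).ne'
  have h2 : ∀ i, ContMDiffAt (𝓘(ℝ, T).prod 𝓘(ℝ, EP)) 𝓘(ℝ, EG) ∞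
      (fun y : T × P => dirDeriv (flux g (A y.1) (Y y.1) c i) y.2
        ((A y.1).hor y.2 (coordField c i (B.proj y.2)))) (t, p) := fun i =>
    contMDiffAt_dirDeriv_family (F := fun t => flux g (A t) (Y t) c i)
      (contMDiffAt_flux_family g hA hY hp i) (contMDiffAt_hor_coordField hA hp i)
  have h5 : ∀ i, ContMDiffAt (𝓘(ℝ, T).prod 𝓘(ℝ, EP)) 𝓘(ℝ, EG) ∞
      (fun y : T × P => (Real.sqrt (gram g c (B.proj y.2)).det)⁻¹ •
        dirDeriv (flux g (A y.1) (Y y.1) c i) y.2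
          ((A y.1).hor y.2 (coordField c i (B.proj y.2)))) (t, p) := fun i => h1.smul (h2 i)
  exact (contMDiffAt_finsetSum (t := Finset.univ) fun i _ => h5 i).neg

/-- The codifferential does not depend on the chart in which it is computed. -/
theorem codiffIn_eq_codiffIn (g : Metric EM M) (A : B.Connection) (Y : B.HorizontalForm)
    {c c' : M} {p : P} (hp : B.proj p ∈ (chartAt EM c).source)
    (hp' : B.proj p ∈ (chartAt EM c').source) : codiffIn g A Y c' p = codiffIn g A Y c p := by
  let e := extChartAt 𝓘(ℝ, EP) p
  let z : EP := e p
  have hez : e.symm z = p := extChartAt_symm_apply_of_mem (mem_chart_source EP p)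
  let a : EP → Matrix (Fin (Module.finrank ℝ EM)) (Fin (Module.finrank ℝ EM)) ℝ :=
    fun y => transitionJacobian EM c c' (B.proj (e.symm y))
  have haz : a z = transitionJacobian EM c c' (B.proj p) :=
    congrArg (fun q => transitionJacobian EM c c' (B.proj q)) hez
  have hJ : ∀ i k, ContMDiffAt 𝓘(ℝ, EP) 𝓘(ℝ, ℝ) ∞
      (fun q => transitionJacobian EM c c' (B.proj q) i k) p := fun i k =>
    (contMDiffAt_transitionJacobian hp hp' i k).comp p B.smooth_proj.contMDiffAt
  -- The Jacobian is pulled back from M, so its derivative along a horizontal lift is the derivative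
  -- along the coordinate field below, and the symmetry on M applies.
  have hsymm : ∀ i j k, fderiv ℝ (fun y => a y i k) z (A.hor p (coordField c' j (B.proj p))) =
      fderiv ℝ (fun y => a y j k) z (A.hor p (coordField c' i (B.proj p))) := by
    have key : ∀ i j k, fderiv ℝ (fun y => a y i k) z (A.hor p (coordField c' j (B.proj p))) =
        mfderiv 𝓘(ℝ, EM) 𝓘(ℝ, ℝ) (fun y => transitionJacobian EM c c' y i k) (B.proj p)
          (coordField c' j (B.proj p)) := by
      intro i j k
      have h1 := mfderiv_comp_apply p
        ((contMDiffAt_transitionJacobian hp hp' i k).mdifferentiableAt (by simp))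
        (B.smooth_proj.mdifferentiable (by simp) p) (A.hor p (coordField c' j (B.proj p)))
      refine (mfderiv_vector_eq_fderiv ((hJ i k).mdifferentiableAt (by simp)) _).symm.trans ?_
      exact h1.trans (congrArg _ (A.tProj_hor p _))
    intro i j k
    rw [key, key]
    exact mfderiv_transitionJacobian_symm hp hp' i j k
  have hflux : ∀ (d : M), B.proj p ∈ (chartAt EM d).source → ∀ i,
      dirDeriv (flux g A Y d i) p (A.hor p (coordField d i (B.proj p))) =
        fderiv ℝ (flux g A Y d i ∘ e.symm) z (A.hor p (coordField d i (B.proj p))) :=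
    fun d hd i => mfderiv_vector_eq_fderiv
      ((contMDiffAt_flux g A Y hd i).mdifferentiableAt (by simp)) _
  have hnear : ∀ᶠ y in nhds z, B.proj (e.symm y) ∈ (chartAt EM c).source ∧
      B.proj (e.symm y) ∈ (chartAt EM c').source := by
    have hcont : ContinuousAt (fun y => B.proj (e.symm y)) z :=
      (B.smooth_proj.continuous.continuousAt).comp (continuousAt_extChartAt_symm p)
    have hz : B.proj (e.symm z) = B.proj p := congrArg _ hez
    exact Filter.Eventually.and
      (hcont.preimage_mem_nhds ((chartAt EM c).open_source.mem_nhds (hz ▸ hp)))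
      (hcont.preimage_mem_nhds ((chartAt EM c').open_source.mem_nhds (hz ▸ hp')))
  -- The computation takes place in a chart of P, but only derivatives along the lifts of the
  -- coordinate fields enter; these vectors, frozen at `p`, need not span `EP`.
  have main := sum_fderiv_eq_of_change (a := a) (z := z)
    (v := fun k => A.hor p (coordField c k (B.proj p)))
    (v' := fun k => A.hor p (coordField c' k (B.proj p)))
    (F := fun k => flux g A Y c k ∘ e.symm) (F' := fun k => flux g A Y c' k ∘ e.symm)
    (fun i k => (hJ i k).differentiableAt_comp_extChartAt_symm)
    (haz ▸ transitionJacobian_det_ne_zero g hp hp') hsymm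
    (fun i => by
      rw [haz, coordField_eq_sum hp hp' i, map_sum]
      exact Finset.sum_congr rfl fun k _ => map_smul _ _ _)
    (fun k => (contMDiffAt_flux g A Y hp k).differentiableAt_comp_extChartAt_symm)
    (fun i => by
      filter_upwards [hnear] with y hy using flux_change g A Y hy.1 hy.2 i)
  have hpos : |(transitionJacobian EM c c' (B.proj p)).det| ≠ 0 :=
    abs_ne_zero.2 (transitionJacobian_det_ne_zero g hp hp')
  simp only [codiffIn, ← Finset.smul_sum]
  rw [Finset.sum_congr rfl fun i _ => hflux c hp i, Finset.sum_congr rfl fun i _ => hflux c' hp' i,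
    sqrt_gram_det_eq g hp hp']
  -- The factor |det a| of the divergence cancels the one in √|g'|.
  refine congrArg Neg.neg ((congrArg _ main).trans ?_)
  rw [haz, smul_smul]
  congr 1
  field_simp

/-- The codifferential depends smoothly on the connection, the form and the point. -/
theorem contMDiff_codiff_family (g : Metric EM M) {A : T → B.Connection}
    {Y : T → B.HorizontalForm} (hA : IsSmoothFormFamily (fun t => (A t).toOneForm))
    (hY : IsSmoothFormFamily (fun t => (Y t).toOneForm)) :
    ContMDiff (𝓘(ℝ, T).prod 𝓘(ℝ, EP)) 𝓘(ℝ, EG) ∞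
      (fun y : T × P => codiff g (A y.1) (Y y.1) y.2) := by
  rintro ⟨t, p⟩
  -- The chart in `codiff` moves with the point. By chart independence it may be frozen at the one
  -- centred at π(p) for all nearby points.
  refine (contMDiffAt_codiffIn_family g hA hY (mem_chart_source EM (B.proj p))).congr_of_eventuallyEq
    ?_
  have h : ContinuousAt (fun y : T × P => B.proj y.2) (t, p) :=
    (B.smooth_proj.continuous.comp continuous_snd).continuousAt
  filter_upwards [h.preimage_mem_nhds (chart_source_mem_nhds EM (B.proj p))] with y hy
  exact codiffIn_eq_codiffIn g (A y.1) (Y y.1) hy (mem_chart_source EM (B.proj y.2))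

theorem flux_smul (g : Metric EM M) (A : B.Connection) (Y : B.HorizontalForm) (c : M)
    (i : Fin (Module.finrank ℝ EM)) (a : G) (q : P) :
    flux g A Y c i (op a • q) = Ad a⁻¹ (flux g A Y c i q) := by
  simp only [flux, map_sum, map_smul]
  refine Finset.sum_congr rfl fun j _ => ?_
  rw [B.proj_act]
  refine congrArg _ ?_
  exact (Y.toOneForm.congr_point rfl (A.tAct_hor a q _).symm).trans (Y.equivariant a q _)

/-- The chart and the metric coefficients depend only on π(p); the flux is equivariant, the lifts
are invariant, and the linear map Ad_{a⁻¹} commutes with differentiation. -/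
theorem codiff_smul (g : Metric EM M) (A : B.Connection) (Y : B.HorizontalForm) (a : G) (p : P) :
    codiff g A Y (op a • p) = Ad a⁻¹ (codiff g A Y p) := by
  rw [codiff_eq_codiffIn, codiff_eq_codiffIn, B.proj_act]
  simp only [codiffIn, map_neg, map_sum, map_smul]
  refine congrArg Neg.neg (Finset.sum_congr rfl fun i _ => congrArg₂ _ (by rw [B.proj_act]) ?_)
  rw [B.proj_act]
  have hp := mem_chart_source EM (B.proj p)
  have hf : ∀ q, B.proj q = B.proj p →
      MDifferentiableAt 𝓘(ℝ, EP) 𝓘(ℝ, EG) (flux g A Y (B.proj p) i) q := fun q hq =>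
    (contMDiffAt_flux g A Y (hq ▸ hp) i).mdifferentiableAt (by simp)
  have h1 := mfderiv_comp_apply p (hf _ (B.proj_act p a))
    ((B.smooth_act_right a).mdifferentiable (by simp) p) (A.hor p (coordField (B.proj p) i (B.proj p)))
  have h2 : flux g A Y (B.proj p) i ∘ (fun q : P => op a • q) =
      (Ad a⁻¹ : EG →L[ℝ] EG) ∘ flux g A Y (B.proj p) i := funext fun q => flux_smul g A Y _ i a q
  have h3 := mfderiv_comp_apply p (I' := 𝓘(ℝ, EG)) (I'' := 𝓘(ℝ, EG))
    ((Ad a⁻¹ : EG →L[ℝ] EG).differentiableAt.mdifferentiableAt) (hf p rfl)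
    (A.hor p (coordField (B.proj p) i (B.proj p)))
  rw [h2] at h1
  refine (congrArg _ (A.tAct_hor a p _).symm).trans (h1.symm.trans (h3.trans ?_))
  rw [mfderiv_eq_fderiv, ContinuousLinearMap.fderiv]
  rfl

end Codifferential

end PrincipalBundle

end EYM

namespace EYM.PrincipalBundle

/-! ### The inner product on 𝔤 -/

section InnerProduct

variable {EG G : Type*} [NormedAddCommGroup EG] [NormedSpace ℝ EG] [TopologicalSpace G]
  [ChartedSpace EG G] [Group G]

theorem AdInvariantInner.eq_zero_of_form_self (γ : AdInvariantInner EG G) {ξ : EG}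
    (h : γ.form ξ ξ = 0) : ξ = 0 := by
  by_contra hξ
  exact (γ.pos ξ hξ).ne' h

theorem AdInvariantInner.form_self_nonneg (γ : AdInvariantInner EG G) (ξ : EG) :
    0 ≤ γ.form ξ ξ := by
  by_cases h : ξ = 0
  · simp [h]
  · exact (γ.pos ξ h).le

theorem AdInvariantInner.form_Ad_inv [LieGroup 𝓘(ℝ, EG) ∞ G] (γ : AdInvariantInner EG G) (g : G)
    (ξ ζ : EG) : γ.form (Ad g⁻¹ ξ) ζ = γ.form ξ (Ad g ζ) := by
  rw [← γ.invariant g, Ad_Ad_inv]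

/-- The isomorphism `𝔤^* → 𝔤` given by an inner product. -/
theorem AdInvariantInner.exists_sharp [FiniteDimensional ℝ EG] (γ : AdInvariantInner EG G) :
    ∃ S : (EG →L[ℝ] ℝ) →L[ℝ] EG, ∀ ν, γ.form (S ν) = ν := by
  have hinj : Function.Injective γ.form.toLinearMap := by
    rw [injective_iff_map_eq_zero]
    intro ξ hξ
    exact γ.eq_zero_of_form_self (congrArg (fun L : EG →L[ℝ] ℝ => L ξ) hξ)
  have hdim : Module.finrank ℝ EG = Module.finrank ℝ (EG →L[ℝ] ℝ) :=
    (Subspace.dual_finrank_eq (K := ℝ) (V := EG)).symm.trans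
      (LinearMap.toContinuousLinearMap (𝕜 := ℝ) (E := EG) (F' := ℝ)).finrank_eq
  let e := LinearMap.linearEquivOfInjective γ.form.toLinearMap hinj hdim
  exact ⟨e.symm.toLinearMap.toContinuousLinearMap, fun ν => e.apply_symm_apply ν⟩

end InnerProduct

/-! ### Raising indices with the metric in a chart -/

section ChartFrame

variable {EM M : Type*} [NormedAddCommGroup EM] [NormedSpace ℝ EM] [TopologicalSpace M]
  [ChartedSpace EM M] [IsManifold 𝓘(ℝ, EM) ∞ M] [FiniteDimensional ℝ EM]

theorem exists_sum_coordField {c x : M} (hx : x ∈ (chartAt EM c).source)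
    (v : TangentSpace 𝓘(ℝ, EM) x) :
    ∃ a : Fin (Module.finrank ℝ EM) → ℝ, v = ∑ l, a l • coordField c l x := by
  let L : EM →L[ℝ] EM := mfderiv 𝓘(ℝ, EM) 𝓘(ℝ, EM) (extChartAt 𝓘(ℝ, EM) c).symm
    (extChartAt 𝓘(ℝ, EM) c x)
  have hinj : Function.Injective L.toLinearMap := mfderiv_extChartAt_symm_injective hx
  have hL : Function.Surjective L :=
    (LinearMap.injective_iff_surjective (f := L.toLinearMap)).1 hinj
  obtain ⟨w, rfl⟩ := hL v
  refine ⟨fun l => (Module.finBasis ℝ EM).repr w l, ?_⟩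
  have h := congrArg L ((Module.finBasis ℝ EM).sum_repr w)
  rw [map_sum] at h
  refine h.symm.trans (Finset.sum_congr rfl fun l _ => ?_)
  exact map_smul L _ _

/-- The vector field dual to the covector with components `μ`, in the chart centred at `c`. -/
noncomputable def sharpIn (g : Metric EM M) (c x : M) (μ : Fin (Module.finrank ℝ EM) → ℝ) :
    TangentSpace 𝓘(ℝ, EM) x :=
  ∑ i, (∑ j, (gram g c x)⁻¹ i j * μ j) • coordField c i x

theorem inner_sharpIn (g : Metric EM M) {c x : M} (hx : x ∈ (chartAt EM c).source)
    (μ : TangentSpace 𝓘(ℝ, EM) x →L[ℝ] ℝ) (v : TangentSpace 𝓘(ℝ, EM) x) :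
    g.inner x (sharpIn g c x fun j => μ (coordField c j x)) v = μ v := by
  obtain ⟨a, rfl⟩ := exists_sum_coordField hx v
  simp only [map_sum, map_smul]
  refine Finset.sum_congr rfl fun l _ => congrArg _ ?_
  simp only [sharpIn, map_sum, map_smul, sum_apply, smul_apply, smul_eq_mul]
  have h1 : ∀ i, g.inner x (coordField c i x) (coordField c l x) = gram g c x l i := fun i =>
    g.symm x _ _
  simp only [h1, Finset.sum_mul]
  rw [Finset.sum_comm]
  have h2 : ∀ j, ∑ i, gram g c x l i * (gram g c x)⁻¹ i j = if l = j then 1 else 0 := by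
    intro j
    have := congrFun₂ (Matrix.mul_nonsing_inv (gram g c x) (gram_det_pos g hx).ne'.isUnit) l j
    rwa [Matrix.mul_apply, Matrix.one_apply] at this
  calc ∑ j, ∑ i, (gram g c x)⁻¹ i j * μ (coordField c j x) * gram g c x l i
      = ∑ j, (∑ i, gram g c x l i * (gram g c x)⁻¹ i j) * μ (coordField c j x) := by
        refine Finset.sum_congr rfl fun j _ => ?_
        rw [Finset.sum_mul]
        exact Finset.sum_congr rfl fun i _ => by ring
    _ = μ (coordField c l x) := by simp [h2]

omit [FiniteDimensional ℝ EM] in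
theorem inner_congr (g : Metric EM M) {x y : M} {v v' w w' : EM} (h : x = y) (hv : v = v')
    (hw : w = w') : (g.inner x v w : ℝ) = g.inner y v' w' := by
  subst h hv hw
  rfl

omit [FiniteDimensional ℝ EM] in
theorem inner_self_nonneg (g : Metric EM M) (x : M) (v : TangentSpace 𝓘(ℝ, EM) x) :
    0 ≤ g.inner x v v := by
  by_cases h : v = 0
  · simp [h]
  · exact (g.pos x v h).le

end ChartFrame

variable {EG EP EM G P M T : Type*}
  [NormedAddCommGroup EG] [NormedSpace ℝ EG] [NormedAddCommGroup EP] [NormedSpace ℝ EP]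
  [NormedAddCommGroup EM] [NormedSpace ℝ EM] [FiniteDimensional ℝ EM]
  [TopologicalSpace G] [ChartedSpace EG G] [Group G] [LieGroup 𝓘(ℝ, EG) ∞ G]
  [TopologicalSpace P] [ChartedSpace EP P] [IsManifold 𝓘(ℝ, EP) ∞ P]
  [TopologicalSpace M] [ChartedSpace EM M] [IsManifold 𝓘(ℝ, EM) ∞ M]
  [MulAction Gᵐᵒᵖ P] {B : PrincipalBundle EG EP EM G P M}
  [NormedAddCommGroup T] [NormedSpace ℝ T]

/-! ### Representing invariant forms by the Kaluza-Klein metric -/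

section KaluzaKlein

omit [FiniteDimensional ℝ EM] in
-- K_A is positive definite: K_A(w, w) is a sum of two nonnegative terms, and if it vanishes then Tπ
-- w = 0 and A w = 0, whence w = 0.
theorem kaluzaKlein_nondegenerate (g : Metric EM M) (γ : AdInvariantInner EG G) (A : B.Connection)
    {p : P} {v v' : TangentSpace 𝓘(ℝ, EP) p}
    (h : ∀ u, kaluzaKlein g γ A p v u = kaluzaKlein g γ A p v' u) : v = v' := by
  have h0 : kaluzaKlein g γ A p (v - v') (v - v') = 0 := by
    have := h (v - v')
    simp only [kaluzaKlein] at this ⊢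
    simp only [map_sub (B.tProj p) v v', map_sub (A.toFun p) v v', map_sub, sub_apply] at this ⊢
    linarith
  have h1 := inner_self_nonneg g (B.proj p) (B.tProj p (v - v'))
  have h2 := γ.form_self_nonneg (A.toFun p (v - v'))
  have h3 : B.tProj p (v - v') = 0 := by
    by_contra hne
    have := g.pos (B.proj p) _ hne
    simp only [kaluzaKlein] at h0
    linarith
  have h4 : A.toFun p (v - v') = 0 := by
    refine γ.eq_zero_of_form_self (le_antisymm ?_ h2)
    simp only [kaluzaKlein] at h0
    linarith
  refine A.ext_tangent ?_ ?_
  · rwa [map_sub, sub_eq_zero] at h3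
  · rwa [map_sub, sub_eq_zero] at h4

omit [FiniteDimensional ℝ EM] in
theorem kaluzaKlein_tAct (g : Metric EM M) (γ : AdInvariantInner EG G) (A : B.Connection) (a : G)
    (p : P) (u v : TangentSpace 𝓘(ℝ, EP) p) :
    kaluzaKlein g γ A (op a • p) (B.tAct a p u) (B.tAct a p v) = kaluzaKlein g γ A p u v := by
  refine congrArg₂ (· + ·) (inner_congr g (B.proj_act p a) (B.tProj_tAct a p u)
    (B.tProj_tAct a p v)) ?_
  rw [A.equivariant, A.equivariant]
  exact γ.invariant a⁻¹ _ _

variable [FiniteDimensional ℝ EP]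

/-- The Kaluza-Klein metric is non-degenerate on invariant fields: every invariant one-form is
represented by a smooth invariant vector field. -/
theorem exists_invariantField [FiniteDimensional ℝ EG] (g : Metric EM M)
    (γ : AdInvariantInner EG G) (m : B.InvariantForm) (A : B.Connection) :
    ∃ V : B.InvariantField, ∀ p u, m.toFun p u = kaluzaKlein g γ A p (V.toFun p) u := by
  obtain ⟨S, hS⟩ := γ.exists_sharp
  -- The horizontal part is the metric dual of Hor_A^* ∘ m, written in the chart centred at `c`; the
  -- vertical part is generated by the γ-dual of the momentum.
  let VIn : M → ∀ p : P, TangentSpace 𝓘(ℝ, EP) p := fun c p =>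
    A.hor p (sharpIn g c (B.proj p) fun j => m.toFun p (A.hor p (coordField c j (B.proj p)))) +
      B.infGen p (S (m.momentum.toFun p))
  have hV : ∀ c p, B.proj p ∈ (chartAt EM c).source → ∀ u,
      m.toFun p u = kaluzaKlein g γ A p (VIn c p) u := by
    intro c p hp u
    have h1 : B.tProj p (VIn c p) = sharpIn g c (B.proj p) fun j =>
        m.toFun p (A.hor p (coordField c j (B.proj p))) := by
      simp only [VIn]
      rw [map_add, A.tProj_hor, B.tProj_infGen, add_zero]
    have h2 : A.toFun p (VIn c p) = S (m.momentum.toFun p) := by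
      simp only [VIn]
      rw [map_add, A.apply_hor, A.reproduces, zero_add]
    rw [kaluzaKlein, h1, h2, hS]
    refine Eq.trans ?_ (congrArg (· + _)
      (inner_sharpIn g hp ((m.toFun p).comp (A.hor p)) (B.tProj p u)).symm)
    change m.toFun p u = m.toFun p (A.hor p (B.tProj p u)) + m.toFun p (B.infGen p (A.toFun p u))
    rw [← map_add, A.hor_add_infGen]
  have hsmooth : ∀ c p, B.proj p ∈ (chartAt EM c).source →
      ContMDiffAt 𝓘(ℝ, EP) 𝓘(ℝ, EP).tangent ∞
        (fun q => (⟨q, VIn c q⟩ : TangentBundle 𝓘(ℝ, EP) P)) p := by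
    intro c p hp
    have hA : IsSmoothFormFamily (fun _ : ℝ => A.toOneForm) := isSmoothFormFamily_const _
    have hm : IsSmoothFormFamily (fun _ : ℝ => m.toOneForm) := isSmoothFormFamily_const _
    have h0 : ContMDiffAt 𝓘(ℝ, EP) 𝓘(ℝ, ℝ) ∞ (fun _ : P => (0 : ℝ)) p := contMDiffAt_const
    have hcoord : ∀ j, ContMDiffAt 𝓘(ℝ, EP) 𝓘(ℝ, EM).tangent ∞
        (fun q => (⟨B.proj q, coordField c j (B.proj q)⟩ : TangentBundle 𝓘(ℝ, EM) M)) p := fun j =>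
      contMDiffAt_coordField j hp B.smooth_proj.contMDiffAt
    have hμ : ∀ j, ContMDiffAt 𝓘(ℝ, EP) 𝓘(ℝ, ℝ) ∞
        (fun q => (m.toFun q (A.hor q (coordField c j (B.proj q))) : ℝ)) p := fun j =>
      hm.contMDiffAt_apply h0 (contMDiffAt_hor (A := fun _ : ℝ => A) hA h0 contMDiffAt_id (hcoord j))
    have hG : ∀ i j, ContMDiffAt 𝓘(ℝ, EP) 𝓘(ℝ, ℝ) ∞
        (fun q => (gram g c (B.proj q))⁻¹ i j) p := fun i j =>
      ContMDiffAt.comp (g := fun x => (gram g c x)⁻¹ i j) p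
        (contMDiffAt_matrix_inv (fun i j => contMDiffAt_gram g hp i j) (gram_det_pos g hp).ne' i j)
        B.smooth_proj.contMDiffAt
    have hsharp : ContMDiffAt 𝓘(ℝ, EP) 𝓘(ℝ, EM).tangent ∞
        (fun q => (⟨B.proj q, sharpIn g c (B.proj q) fun j =>
          m.toFun q (A.hor q (coordField c j (B.proj q)))⟩ : TangentBundle 𝓘(ℝ, EM) M)) p := by
      refine contMDiffAt_tangentVector_sum Finset.univ B.smooth_proj.contMDiffAt fun i _ => ?_
      refine contMDiffAt_tangentVector_smul ?_ (hcoord i)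
      exact contMDiffAt_finsetSum fun j _ => (hG i j).mul (hμ j)
    refine contMDiffAt_tangentVector_add
      (contMDiffAt_hor (A := fun _ : ℝ => A) hA h0 contMDiffAt_id hsharp) ?_
    exact B.contMDiffAt_infGen contMDiffAt_id
      (S.contDiff.contMDiff.contMDiffAt.comp p m.momentum.smooth.contMDiffAt)
  -- Each point uses the chart centred at its own projection. Where two charts overlap, both fields
  -- represent `m`, so they agree by nondegeneracy; smoothness is inherited from the field of a
  -- fixed chart.
  refine ⟨⟨fun p => VIn (B.proj p) p, fun p => ?_, fun a p => ?_⟩,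
    fun p => hV _ p (mem_chart_source EM (B.proj p))⟩
  · refine (hsmooth (B.proj p) p (mem_chart_source EM (B.proj p))).congr_of_eventuallyEq ?_
    filter_upwards [B.smooth_proj.continuous.continuousAt.preimage_mem_nhds
      (chart_source_mem_nhds EM (B.proj p))] with q hq
    refine tangentBundle_mk_eq rfl (kaluzaKlein_nondegenerate g γ A fun u => ?_)
    rw [← hV _ q (mem_chart_source EM (B.proj q)), ← hV _ q hq]
  -- Invariance also follows from uniqueness: every vector at p·a is a translate, and both `m` and
  -- K_A are invariant.
  · refine kaluzaKlein_nondegenerate g γ A fun u => ?_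
    obtain ⟨u, rfl⟩ := B.tAct_surjective a p u
    rw [← hV _ (op a • p) (mem_chart_source EM _), kaluzaKlein_tAct,
      ← hV _ p (mem_chart_source EM _), m.invariant]

end KaluzaKlein

/-! ### The momentum level set as a graph -/

section LevelSet

variable [FiniteDimensional ℝ EP] [FiniteDimensional ℝ EG]

omit [FiniteDimensional ℝ EM] [FiniteDimensional ℝ EG] in
-- A vertical field has no horizontal part, so σ(A(N)) = N for every connection `A`.
theorem GaugeField.infGen_apply (N : B.GaugeField) (A : B.Connection) (p : P) :
    B.infGen p (A.toFun p (N.toFun p)) = N.toFun p := by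
  have h := A.hor_add_infGen p (N.toFun p)
  rwa [N.vertical, map_zero, zero_add] at h

/-- Testing m = K_A(V, ·) on generators gives 𝕁 ∘ m = γ(A(V), ·). Applying `A` to σ(δ^A Y - A(V)) =
N gives δ^A Y - A(V) = A(N), and conversely since γ is nondegenerate and `N` is vertical. Writing
the result with A(N) avoids choosing f with σ(f) = N. -/
theorem mem_momentumLevel_iff (g : Metric EM M) (γ : AdInvariantInner EG G) (N : B.GaugeField)
    (z : B.SDual × B.CotangentConn) :
    z ∈ momentumLevel g γ N ↔ ∀ p ξ, z.1.1.momentum.toFun p ξ +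
      γ.form (codiff g z.2.1 z.2.2.neg p + z.2.1.toFun p (N.toFun p)) ξ = 0 := by
  obtain ⟨⟨m, ρs⟩, A, Y⟩ := z
  have hK : ∀ V : B.InvariantField, (∀ p u, m.toFun p u = kaluzaKlein g γ A p (V.toFun p) u) →
      ∀ p ξ, m.momentum.toFun p ξ = γ.form (A.toFun p (V.toFun p)) ξ := by
    intro V hV p ξ
    refine (hV p (B.infGen p ξ)).trans ?_
    rw [kaluzaKlein, B.tProj_infGen, A.reproduces, map_zero, zero_add]
  constructor
  · rintro ⟨V, hV, hN⟩ p ξ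
    have h1 : A.toFun p (N.toFun p) = codiff g A Y p - A.toFun p (V.toFun p) := by
      rw [← hN p]
      exact A.reproduces p _
    change m.momentum.toFun p ξ + γ.form (codiff g A Y.neg p + A.toFun p (N.toFun p)) ξ = 0
    rw [hK V hV, h1, codiff_neg]
    simp only [map_add, map_neg, map_sub, add_apply, neg_apply, sub_apply]
    ring
  · intro h
    obtain ⟨V, hV⟩ := exists_invariantField g γ m A
    refine ⟨V, hV, fun p => ?_⟩
    have h1 : A.toFun p (V.toFun p) + (codiff g A Y.neg p + A.toFun p (N.toFun p)) = 0 := by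
      refine γ.eq_zero_of_form_self ?_
      have h2 : ∀ ξ, γ.form (A.toFun p (V.toFun p) +
          (codiff g A Y.neg p + A.toFun p (N.toFun p))) ξ = 0 := by
        intro ξ
        rw [map_add, add_apply, ← hK V hV]
        exact h p ξ
      exact h2 _
    rw [codiff_neg] at h1
    have h2 : codiff g A Y p - A.toFun p (V.toFun p) = A.toFun p (N.toFun p) := by
      rw [← sub_eq_zero, ← neg_eq_zero, ← h1]
      abel
    exact (congrArg (B.infGen p) h2).trans (N.infGen_apply A p)

/-- The momentum of `σ⁻¹(N) - δ^A Y`, up to the identification of `𝔤` with its dual. -/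
noncomputable def shiftedCodiff (g : Metric EM M) (N : B.GaugeField) (A : B.Connection)
    (Y : B.HorizontalForm) (p : P) : EG :=
  codiff g A Y p + A.toFun p (N.toFun p)

omit [FiniteDimensional ℝ EG] in
theorem contMDiff_shiftedCodiff_family (g : Metric EM M) (N : B.GaugeField) {A : T → B.Connection}
    {Y : T → B.HorizontalForm} (hA : IsSmoothFormFamily (fun t => (A t).toOneForm))
    (hY : IsSmoothFormFamily (fun t => (Y t).toOneForm)) :
    ContMDiff (𝓘(ℝ, T).prod 𝓘(ℝ, EP)) 𝓘(ℝ, EG) ∞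
      (fun y : T × P => shiftedCodiff g N (A y.1) (Y y.1) y.2) := by
  have h0 := contMDiff_codiff_family g hA hY
  have h : ContMDiff (𝓘(ℝ, T).prod 𝓘(ℝ, EP)) 𝓘(ℝ, EG) ∞
      (fun y : T × P => ((A y.1).toFun y.2 (N.toFun y.2) : EG)) := fun y =>
    hA.contMDiffAt_apply contMDiff_fst.contMDiffAt (N.smooth.comp contMDiff_snd).contMDiffAt
  exact h0.add h

omit [FiniteDimensional ℝ EG] in
theorem shiftedCodiff_smul (g : Metric EM M) (N : B.GaugeField) (A : B.Connection)
    (Y : B.HorizontalForm) (a : G) (p : P) :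
    shiftedCodiff g N A Y (op a • p) = Ad a⁻¹ (shiftedCodiff g N A Y p) := by
  have h : A.toFun (op a • p) (N.toFun (op a • p)) = Ad a⁻¹ (A.toFun p (N.toFun p)) := by
    rw [N.invariant]
    exact A.equivariant a p _
  have h1 := map_add (Ad a⁻¹ : EG →L[ℝ] EG) (codiff g A Y p) (A.toFun p (N.toFun p))
  exact (congrArg₂ (fun x y : EG => x + y) (codiff_smul g A Y a p) h).trans h1.symm

omit [IsManifold 𝓘(ℝ, EP) ∞ P] [FiniteDimensional ℝ EP] [FiniteDimensional ℝ EG] in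
-- A single object is treated as a constant family over ℝ and recovered at parameter `0`.
theorem contMDiff_of_const_family {f : P → EG}
    (h : ContMDiff (𝓘(ℝ, ℝ).prod 𝓘(ℝ, EP)) 𝓘(ℝ, EG) ∞ (fun y : ℝ × P => f y.2)) :
    ContMDiff 𝓘(ℝ, EP) 𝓘(ℝ, EG) ∞ f := by
  have h0 : ContMDiff 𝓘(ℝ, EP) (𝓘(ℝ, ℝ).prod 𝓘(ℝ, EP)) ∞ (fun p : P => ((0 : ℝ), p)) :=
    contMDiff_const.prodMk contMDiff_id
  exact h.comp h0

omit [FiniteDimensional ℝ EG] in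
theorem contMDiff_shiftedCodiff (g : Metric EM M) (N : B.GaugeField) (A : B.Connection)
    (Y : B.HorizontalForm) : ContMDiff 𝓘(ℝ, EP) 𝓘(ℝ, EG) ∞ (shiftedCodiff g N A Y) := by
  have hA : IsSmoothFormFamily (fun _ : ℝ => A.toOneForm) := isSmoothFormFamily_const _
  have hY : IsSmoothFormFamily (fun _ : ℝ => Y.toOneForm) := isSmoothFormFamily_const _
  exact contMDiff_of_const_family
    (contMDiff_shiftedCodiff_family (A := fun _ => A) (Y := fun _ => Y) g N hA hY)

omit [TopologicalSpace P] [FiniteDimensional ℝ EG] in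
theorem neg_form_smul (γ : AdInvariantInner EG G) {f : P → EG}
    (hf : ∀ (a : G) p, f (op a • p) = Ad a⁻¹ (f p)) (a : G) (p : P) :
    -γ.form (f (op a • p)) =
      (ContinuousLinearMap.compL ℝ EG EG ℝ).flip (Ad a) (-γ.form (f p)) := by
  refine ContinuousLinearMap.ext fun ξ => ?_
  have h1 := congrArg Neg.neg (γ.form_Ad_inv a (f p) ξ)
  rw [← hf] at h1
  exact h1

/-- The value of the momentum `ν` on the level set of `N`. -/
noncomputable def levelMomentum (g : Metric EM M) (γ : AdInvariantInner EG G) (N : B.GaugeField)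
    (A : B.Connection) (Y : B.HorizontalForm) : B.CoadMap where
  toFun p := -γ.form (shiftedCodiff g N A Y p)
  smooth := (-γ.form).contDiff.contMDiff.comp (contMDiff_shiftedCodiff g N A Y)
  equivariant p a := neg_form_smul γ (shiftedCodiff_smul g N A Y) a p

omit [FiniteDimensional ℝ EG] in
theorem isSmoothMapFamily_levelMomentum (g : Metric EM M) (γ : AdInvariantInner EG G)
    (N : B.GaugeField) {A : T → B.Connection} {Y : T → B.HorizontalForm}
    (hA : IsSmoothFormFamily (fun t => (A t).toOneForm))
    (hY : IsSmoothFormFamily (fun t => (Y t).toOneForm)) :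
    IsSmoothMapFamily (fun t => levelMomentum g γ N (A t) (Y t)) :=
  (-γ.form).contDiff.contMDiff.comp (contMDiff_shiftedCodiff_family g N hA hY)

/-- In the split variables the level set is a graph: `ν` is a function of `A` and `E`, while n, ρ
and s are unconstrained. -/
theorem mem_momentumLevel_iff_eq (g : Metric EM M) (γ : AdInvariantInner EG G) (N : B.GaugeField)
    (z : B.SDual × B.CotangentConn) :
    z ∈ momentumLevel g γ N ↔
      (B.splitting z).2.1 = levelMomentum g γ N (B.splitting z).2.2.1 (B.splitting z).2.2.2 := by
  rw [mem_momentumLevel_iff]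
  constructor
  · intro h
    exact EquivariantMap.ext fun p => ContinuousLinearMap.ext fun ξ => eq_neg_of_add_eq_zero_left (h p ξ)
  · intro h p ξ
    have := congrArg (fun ν : B.CoadMap => ν.toFun p ξ) h
    exact (congrArg (· + _) this).trans (neg_add_cancel _)

/-- The level set of the momentum map is parametrized by the reduced variables. -/
noncomputable def levelEquiv (g : Metric EM M) (γ : AdInvariantInner EG G) (N : B.GaugeField) :
    momentumLevel g γ N ≃ (B.KDual × B.CotangentConn) where
  toFun z := ((B.splitting z.1).1, (B.splitting z.1).2.2)
  invFun w := ⟨B.splitting.symm (w.1, levelMomentum g γ N w.2.1 w.2.2, w.2), by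
    rw [mem_momentumLevel_iff_eq, Equiv.apply_symm_apply]⟩
  left_inv z := by
    refine Subtype.ext ?_
    change B.splitting.symm ((B.splitting z.1).1, levelMomentum g γ N (B.splitting z.1).2.2.1
      (B.splitting z.1).2.2.2, (B.splitting z.1).2.2) = z.1
    rw [← (mem_momentumLevel_iff_eq g γ N z.1).1 z.2, Equiv.symm_apply_eq]
  right_inv w := by
    change ((B.splitting (B.splitting.symm _)).1, (B.splitting (B.splitting.symm _)).2.2) = w
    rw [Equiv.apply_symm_apply]

/-- Projection from a graph is smooth, and its inverse is smooth because the function defining the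
graph sends smooth families to smooth families, by the family version of the smoothness of the
codifferential. -/
theorem isDiffeo_levelEquiv (g : Metric EM M) (γ : AdInvariantInner EG G) (N : B.GaugeField) :
    IsDiffeo (levelEquiv g γ N) := by
  constructor
  · intro n p hp
    obtain ⟨h1, h2⟩ := isPlot_prod_iff.1 (B.isDiffeo_splitting.1 n _ (isPlot_subtype_iff.1 hp))
    exact isPlot_prod_iff.2 ⟨h1, (isPlot_prod_iff.1 h2).2⟩
  · intro n p hp
    obtain ⟨h1, h2⟩ := isPlot_prod_iff.1 hp
    obtain ⟨hA, hY⟩ := isPlot_prod_iff.1 h2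
    refine isPlot_subtype_iff.2 (B.isDiffeo_splitting.2 n
      (fun t => ((p t).1, levelMomentum g γ N (p t).2.1 (p t).2.2, (p t).2)) ?_)
    refine isPlot_prod_iff.2 ⟨h1, isPlot_prod_iff.2 ⟨?_, h2⟩⟩
    exact isPlot_equivariantMap_iff.2 (isSmoothMapFamily_levelMomentum g γ N
      (isPlot_connection_iff.1 hA) (isPlot_horizontalForm_iff.1 hY))

end LevelSet

end EYM.PrincipalBundle

/-! ### The proposition -/

theorem proposition6p4 {EG EP EM G P M : Type*}
    [NormedAddCommGroup EG] [NormedSpace ℝ EG] [FiniteDimensional ℝ EG]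
    [NormedAddCommGroup EP] [NormedSpace ℝ EP] [FiniteDimensional ℝ EP]
    [NormedAddCommGroup EM] [NormedSpace ℝ EM] [FiniteDimensional ℝ EM]
    [TopologicalSpace G] [ChartedSpace EG G] [Group G] [LieGroup 𝓘(ℝ, EG) ∞ G]
    [TopologicalSpace P] [ChartedSpace EP P] [IsManifold 𝓘(ℝ, EP) ∞ P]
    [TopologicalSpace M] [ChartedSpace EM M] [IsManifold 𝓘(ℝ, EM) ∞ M]
    [T2Space M] [CompactSpace M] [MulAction Gᵐᵒᵖ P]
    (B : PrincipalBundle EG EP EM G P M)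
    (g : Metric EM M) (γ : AdInvariantInner EG G) :
    ∃ i : (B.SDual × B.CotangentConn) ≃ (B.KDual × B.CoadMap × B.CotangentConn),
      IsDiffeo i ∧
      -- the formula `i(m, ρ, s, A, Y) = (Hor_A^* ∘ m, ρ, s, 𝕁 ∘ m, A, -Y)`
      (∀ (m : B.InvariantForm) (ρ s : SmoothFun EM M) (A : B.Connection) (Y : B.HorizontalForm),
        ∃ (n : OneForm EM M ℝ) (ν : B.CoadMap),
          i ((m, ρ, s), (A, Y)) = ((n, ρ, s), ν, (A, Y.neg)) ∧
          (∀ p v, n (B.proj p) v = m.toFun p (A.hor p v)) ∧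
          (∀ p ξ, ν.toFun p ξ = m.toFun p (B.infGen p ξ))) ∧
      -- gauge equivariance
      (∀ (η : B.Gauge) (z : B.SDual × B.CotangentConn),
        i (gaugeAct η z) = gaugeAct' η (i z)) ∧
      -- the image of the level set `J⁻¹(N)` for `N = σ(f)`
      (∀ (N : B.GaugeField) (f : B.AdMap), IsSigma f.toFun N →
        i '' momentumLevel g γ N =
          {w | ∀ p ξ, w.2.1.toFun p ξ +
            γ.form (codiff g w.2.2.1 w.2.2.2 p + f.toFun p) ξ = 0}) ∧
      -- `J⁻¹(N)` is diffeomorphic to `𝔨^* × T^*Conn(P)`, by `i` followed by forgetting `ν`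
      (∀ N : B.GaugeField,
        ∃ j : momentumLevel g γ N ≃ (B.KDual × B.CotangentConn),
          IsDiffeo j ∧ ∀ z, j z = ((i z.1).1, (i z.1).2.2)) := by
  refine ⟨B.splitting, B.isDiffeo_splitting, fun m ρ s A Y => ?_, B.splitting_gaugeAct,
    fun N f hf => ?_, fun N => ⟨levelEquiv g γ N, isDiffeo_levelEquiv g γ N, fun _ => rfl⟩⟩
  · exact ⟨m.horPart A, m.momentum, rfl, m.horPart_apply A, fun _ _ => rfl⟩
  -- Every connection reproduces generators, so A(N) = f whatever `A` is; the graph equation in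
  -- terms of A(N) is thus the one in terms of f.
  · have hN : ∀ (A : B.Connection) p, A.toFun p (N.toFun p) = f.toFun p := fun A p => by
      rw [← hf p]
      exact A.reproduces p _
    ext w
    rw [Equiv.image_eq_preimage_symm, Set.mem_preimage, mem_momentumLevel_iff_eq,
      Equiv.apply_symm_apply]
    constructor
    · intro h p ξ
      have h1 := congrArg (fun ν : B.CoadMap => ν.toFun p ξ) h
      rw [← hN w.2.2.1 p]
      exact (congrArg (· + _) h1).trans (neg_add_cancel _)
    · intro h
      refine EquivariantMap.ext fun p => ContinuousLinearMap.ext fun ξ => ?_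
      have h1 := h p ξ
      rw [← hN w.2.2.1 p] at h1
      exact eq_neg_of_add_eq_zero_left h1
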